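/- **Setting.** Let $\mathcal D$ be a unital complex algebra and $\mathcal M$ a complex algebra, not necessarily unital, which is also a (unital) $\mathcal D$-bimodule. The actions of $\mathcal D$ are compatible with the complex scalars, and all mixed products are associative: $d_1(ad_2)=(d_1a)d_2$, $d(ab)=(da)b$, $(ab)d=a(bd)$, $(ad)b=a(db)$. Let $\langle\cdot\rangle:\mathcal M\to\mathcal D$ be a complex-linear $\mathcal D$-bimodule map. (This includes the case of star-algebras and a star-linear $\langle\cdot\rangle$; the involutions play no role.) Let $\Gamma(\mathcal M)$ be the complex unital algebra generated by $\mathcal D$ and symbols $X(a)$, $a\in\mathcal M$, subject to $X(d_1ad_2+d_3bd_4)=d_1X(a)d_2+d_3X(b)d_4$. Put $M(a_1\otimes\dots\otimes a_n)=X(a_1)\cdots X(a_n)$. Empty products, and $M$ and $W$ of the empty tensor, are $1$. **Wick products.** Define $W=W_{\mathcal{INC}}$ by $W(a_1)=X(a_1)-\langle a_1\rangle$ and, for $n\ge1$, $$W(a_1\otimes\dots\otimes a_{n+1})=W(a_1\otimes\dots\otimes a_n)X(a_{n+1})-W(a_1\otimes\dots\otimes a_n)\langle a_{n+1}\rangle-W(a_1\otimes\dots\otimes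 a_{n-1}\otimes a_na_{n+1})-W(a_1\otimes\dots\otimes a_{n-1})\langle a_na_{n+1}\rangle .$$ **Partitions.** A block of a non-crossing partition is *outer* if none of its elements lies strictly between two elements of another block. $\mathcal{INC}(n)$ is the set of pairs $(\pi,S)$ with $\pi$ a non-crossing partition of $[n]=\{1,\dots,n\}$ and $S$ a set of outer blocks of $\pi$; blocks in $S$ are *open*, those in $\pi\setminus S$ *closed*. $\mathrm{Sing}(\pi)$ is the set of one-element blocks, $\mathrm{Int}(n)$ the set of partitions into intervals, $\hat 0_n$ the partition into singletons, and $\wedge$ the meet for the refinement order. Blocks are ordered by their largest elements. **Nested expectations.** For a finite set $I$ of positions and a partition $\pi$ of $I$ with outer blocks $V_1<\dots<V_\ell$, $V_i=\{v(i,1)<\dots<v(i,t(i))\}$, define recursively $$\langle a\rangle^\pi=\prod_{i=1}^{\ell}\Big\langle a_{v(i,1)}\,e_{i,1}\,a_{v(i,2)}\,e_{i,2}\cdots e_{i,t(i)-1}\,a_{v(i,t(i))}\Big\rangle\in\mathcal D,$$ where $e_{i,j}$ is the nested expectation of the restriction of $\pi$ to the elements of $I$ strictly between $v(i,j)$ and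 $v(i,j+1)$; it is $1$ if there are none. **Contractions.** For $F\in\{M,W\}$ and $(\pi,S)\in\mathcal{INC}(n)$ with $S=\{V_1<\dots<V_\ell\}$, $V_i=\{v(i,1)<\dots<v(i,t(i))\}$, put $$F(a_1\otimes\dots\otimes a_n)^{(\pi,S)}=e_0\,F\Big(\bigotimes_{i=1}^{\ell}\ \prod_{j=1}^{t(i)}a_{v(i,j)}e_{i,j}\Big),$$ where $e_0$ is the nested expectation of $\pi$ restricted to the positions before all open blocks, and $e_{i,j}$ that of $\pi$ restricted to the positions strictly between $v(i,j)$ and the next element of $\bigcup S$ (or the end $n+1$). **Claim.** $W$ is additive in each argument and satisfies $W(\dots\otimes ad\otimes b\otimes\cdots)=W(\dots\otimes a\otimes db\otimes\cdots)$, $W(da_1\otimes\cdots)=d\,W(a_1\otimes\cdots)$ and $W(\cdots\otimes a_nd)=W(\cdots\otimes a_n)\,d$, so it defines a $\mathcal D$-bimodule map on each $\mathcal M^{\otimes_{\mathcal D}n}$. Moreover, for all $n$ and $a_1,\dots,a_n\in\mathcal M$: 1. $\displaystyle X(a_1)\cdots X(a_n)=\sum_{(\pi,S)\in\mathcal{INC}(n)}W(a_1\otimes\dots\otimes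 a_n)^{(\pi,S)}.$ 2. $\displaystyle W(a_1\otimes\dots\otimes a_n)=\sum_{\substack{(\pi,S)\in\mathcal{INC}(n),\ \pi\in\mathrm{Int}(n)\\ U\in\pi\setminus S\Rightarrow|U|=1}}(-1)^{n-|S|}\,M(a_1\otimes\dots\otimes a_n)^{(\pi,S)}.$ 3. If $n=s(1)+\dots+s(k)$ with all $s(i)\ge1$, $J_1,\dots,J_k$ are the consecutive intervals of $[n]$ of lengths $s(1),\dots,s(k)$, and $\rho=\{J_1,\dots,J_k\}$, then $$\prod_{i=1}^{k}W\Big(\bigotimes_{j\in J_i}a_j\Big)=\sum_{\substack{(\pi,S)\in\mathcal{INC}(n),\ \pi\wedge\rho=\hat0_n\\ \mathrm{Sing}(\pi)\subset S}}W(a_1\otimes\dots\otimes a_n)^{(\pi,S)}$$ (the product taken in increasing order of $i$). -/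

import Mathlib

/-! ### Incomplete non-crossing partitions -/

/-- A partition of a finite set `I` of positions is non-crossing if no two distinct blocks `U`, `V`
contain `i, k ∈ U` and `j, l ∈ V` with `i < j < k < l`. -/
def IsNoncrossing {n : ℕ} {I : Finset (Fin n)} (π : Finpartition I) : Prop :=
  ∀ U ∈ π.parts, ∀ V ∈ π.parts, U ≠ V →
    ∀ i ∈ U, ∀ k ∈ U, ∀ j ∈ V, ∀ l ∈ V, ¬ (i < j ∧ j < k ∧ k < l)

set_option synthInstance.maxSize 1000 in
instance {n : ℕ} {I : Finset (Fin n)} (π : Finpartition I) : Decidable (IsNoncrossing π) := by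
  unfold IsNoncrossing; infer_instance

/-- The outer blocks (blocks of depth zero): those containing no element that lies strictly between
two elements of one other block. -/
def outerBlocks {n : ℕ} {I : Finset (Fin n)} (π : Finpartition I) : Finset (Finset (Fin n)) :=
  π.parts.filter fun U =>
    ∀ V ∈ π.parts, V ≠ U → ∀ x ∈ U, ∀ i ∈ V, ∀ j ∈ V, ¬ (i < x ∧ x < j)

/-- `INC(n)`: pairs `(π, S)` of a non-crossing partition `π` of the `n` positions and a set `S` of
outer blocks of `π`. The members of `S` are the open blocks, those of `π.parts \ S` the closed
ones. -/
def INC (n : ℕ) :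
    Finset (Finpartition (Finset.univ : Finset (Fin n)) × Finset (Finset (Fin n))) :=
  Finset.univ.filter fun p => IsNoncrossing p.1 ∧ p.2 ⊆ outerBlocks p.1

/-- Interval partitions: every block is an interval. -/
def IsIntervalPartition {n : ℕ} {I : Finset (Fin n)} (π : Finpartition I) : Prop :=
  ∀ U ∈ π.parts, ∀ i ∈ U, ∀ k ∈ U, ∀ j ∈ I, i ≤ j → j ≤ k → j ∈ U

instance {n : ℕ} {I : Finset (Fin n)} (π : Finpartition I) :
    Decidable (IsIntervalPartition π) := by
  unfold IsIntervalPartition; infer_instance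

/-- `Sing(π)`: the one-element blocks. -/
def singletonBlocks {n : ℕ} {I : Finset (Fin n)} (π : Finpartition I) :
    Finset (Finset (Fin n)) :=
  π.parts.filter fun U => U.card = 1

/-- For a composition `n = s(1) + ⋯ + s(k)`, the partition of the `n` positions into the consecutive
intervals `J_1, …, J_k` of lengths `s(1), …, s(k)`. -/
def blockPartition {n : ℕ} (c : Composition n) :
    Finpartition (Finset.univ : Finset (Fin n)) :=
  @Finpartition.ofSetoid (Fin n) _ _ (Setoid.ker c.index)
    (fun i j => decEq (c.index i) (c.index j))

/-- The sets in `C`, listed in increasing order of their largest elements. -/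
noncomputable def sortByMax {n : ℕ} (C : Finset (Finset (Fin n))) : List (Finset (Fin n)) :=
  C.toList.mergeSort fun U V => decide (U.max ≤ V.max)

/-- The elements of `I` strictly between `v` and the next element of `A` after `v`; if `A` has no
element after `v`, all elements of `I` after `v`. -/
def gapAfter {n : ℕ} (I A : Finset (Fin n)) (v : Fin n) : Finset (Fin n) :=
  I.filter fun x => v < x ∧ ∀ w ∈ A, v < w → x < w

/-- The elements of `I` strictly between `v` and the next element of `V` after `v`; if `V` has no
element after `v`, the empty set. -/
def gapInside {n : ℕ} (I V : Finset (Fin n)) (v : Fin n) : Finset (Fin n) :=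
  I.filter fun x => v < x ∧ (∃ w ∈ V, x < w) ∧ ∀ w ∈ V, v < w → x < w

/-- The elements of `I` that precede every element of `A`. -/
def gapBefore {n : ℕ} (I A : Finset (Fin n)) : Finset (Fin n) :=
  I.filter fun x => ∀ w ∈ A, x < w

/-! ### The algebra `Γ(M)`

`D` is a unital complex algebra and `M` a complex algebra, not necessarily unital, which is also a
`D`-bimodule. The left action is `d • a`, the right action `a d` is `MulOpposite.op d • a`. -/

/-- The generators of `Γ(M)`: a symbol for each `a : M` and each `d : D`. -/
abbrev GammaFree (D M : Type*) : Type _ := FreeAlgebra ℂ (M ⊕ D)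

/-- The defining relations of `Γ(M)`: `D` is a unital complex subalgebra, and
`X(d₁ a d₂ + d₃ b d₄) = d₁ X(a) d₂ + d₃ X(b) d₄`. -/
inductive GammaRel (D M : Type*) [Ring D] [Algebra ℂ D] [AddCommGroup M]
    [Module D M] [Module Dᵐᵒᵖ M] : GammaFree D M → GammaFree D M → Prop
  | coeff_add (d e : D) : GammaRel D M (FreeAlgebra.ι ℂ (Sum.inr (d + e)))
      (FreeAlgebra.ι ℂ (Sum.inr d) + FreeAlgebra.ι ℂ (Sum.inr e))
  | coeff_mul (d e : D) : GammaRel D M (FreeAlgebra.ι ℂ (Sum.inr (d * e)))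
      (FreeAlgebra.ι ℂ (Sum.inr d) * FreeAlgebra.ι ℂ (Sum.inr e))
  | coeff_algebraMap (z : ℂ) : GammaRel D M (FreeAlgebra.ι ℂ (Sum.inr (algebraMap ℂ D z)))
      (algebraMap ℂ (GammaFree D M) z)
  | X_bimodule (d₁ d₂ d₃ d₄ : D) (a b : M) : GammaRel D M
      (FreeAlgebra.ι ℂ (Sum.inl
        (d₁ • (MulOpposite.op d₂ • a) + d₃ • (MulOpposite.op d₄ • b))))
      (FreeAlgebra.ι ℂ (Sum.inr d₁) * FreeAlgebra.ι ℂ (Sum.inl a) * FreeAlgebra.ι ℂ (Sum.inr d₂) +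
        FreeAlgebra.ι ℂ (Sum.inr d₃) * FreeAlgebra.ι ℂ (Sum.inl b) *
          FreeAlgebra.ι ℂ (Sum.inr d₄))

/-- `Γ(M)`: the complex unital algebra generated by `D` and the symbols `X(a)`, `a : M`, subject to
the relations `GammaRel`. -/
def Gamma (D M : Type*) [Ring D] [Algebra ℂ D] [AddCommGroup M]
    [Module D M] [Module Dᵐᵒᵖ M] : Type _ :=
  RingQuot (GammaRel D M)

namespace Gamma

noncomputable instance (D M : Type*) [Ring D] [Algebra ℂ D] [AddCommGroup M]
    [Module D M] [Module Dᵐᵒᵖ M] : Ring (Gamma D M) :=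
  inferInstanceAs (Ring (RingQuot (GammaRel D M)))

noncomputable instance (D M : Type*) [Ring D] [Algebra ℂ D] [AddCommGroup M]
    [Module D M] [Module Dᵐᵒᵖ M] : Algebra ℂ (Gamma D M) :=
  inferInstanceAs (Algebra ℂ (RingQuot (GammaRel D M)))

/-- The generator `X(a)` of `Γ(M)`. -/
noncomputable def X (D : Type*) {M : Type*} [Ring D] [Algebra ℂ D] [AddCommGroup M]
    [Module D M] [Module Dᵐᵒᵖ M] (a : M) : Gamma D M :=
  RingQuot.mkAlgHom ℂ (GammaRel D M) (FreeAlgebra.ι ℂ (Sum.inl a))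

/-- The element of `Γ(M)` given by `d : D`. -/
noncomputable def coeff {D : Type*} (M : Type*) [Ring D] [Algebra ℂ D] [AddCommGroup M]
    [Module D M] [Module Dᵐᵒᵖ M] (d : D) : Gamma D M :=
  RingQuot.mkAlgHom ℂ (GammaRel D M) (FreeAlgebra.ι ℂ (Sum.inr d))

end Gamma

/-! ### Monomials, Wick products and nested contractions -/

/-- The product of a nonempty list in an algebra that may have no unit (`0` on the empty list, a
value that is never used). -/
def nonunitalProd {M : Type*} [NonUnitalRing M] : List M → M
  | [] => 0
  | [a] => a
  | a :: b :: l => a * nonunitalProd (b :: l)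

/-- The monomial `M(a₁ ⊗ ⋯ ⊗ aₙ) = X(a₁) ⋯ X(aₙ)`. -/
noncomputable def monomialProd (D : Type*) {M : Type*} [Ring D] [Algebra ℂ D] [NonUnitalRing M]
    [Module D M] [Module Dᵐᵒᵖ M] (l : List M) : Gamma D M :=
  (l.map (Gamma.X D)).prod

/-- The Wick product of the *reversed* list `[aₙ, …, a₁]`. -/
noncomputable def wickRev {D M : Type*} [Ring D] [Algebra ℂ D] [NonUnitalRing M]
    [Module D M] [Module Dᵐᵒᵖ M] (E : M → D) : List M → Gamma D M
  | [] => 1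
  | [a] => Gamma.X D a - Gamma.coeff M (E a)
  | b :: a :: l =>
      wickRev E (a :: l) * Gamma.X D b - wickRev E (a :: l) * Gamma.coeff M (E b)
        - wickRev E ((a * b) :: l) - wickRev E l * Gamma.coeff M (E (a * b))
termination_by l => l.length

/-- The Wick product `W(a₁ ⊗ ⋯ ⊗ aₙ)`, as a function of the list `[a₁, …, aₙ]`; it is characterized
by the lemmas `wick_nil`, `wick_singleton` and `wick_append` below. -/
noncomputable def wick {D M : Type*} [Ring D] [Algebra ℂ D] [NonUnitalRing M]
    [Module D M] [Module Dᵐᵒᵖ M] (E : M → D) (l : List M) : Gamma D M :=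
  wickRev E l.reverse

theorem wick_nil {D M : Type*} [Ring D] [Algebra ℂ D] [NonUnitalRing M]
    [Module D M] [Module Dᵐᵒᵖ M] (E : M → D) : wick E ([] : List M) = 1 := by
  simp [wick, wickRev]

theorem wick_singleton {D M : Type*} [Ring D] [Algebra ℂ D] [NonUnitalRing M]
    [Module D M] [Module Dᵐᵒᵖ M] (E : M → D) (a : M) :
    wick E [a] = Gamma.X D a - Gamma.coeff M (E a) := by
  simp [wick, wickRev]

/-- The four-term recursion. -/
theorem wick_append {D M : Type*} [Ring D] [Algebra ℂ D] [NonUnitalRing M]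
    [Module D M] [Module Dᵐᵒᵖ M] (E : M → D) (l : List M) (a b : M) :
    wick E (l ++ [a, b]) =
      wick E (l ++ [a]) * Gamma.X D b - wick E (l ++ [a]) * Gamma.coeff M (E b)
        - wick E (l ++ [a * b]) - wick E l * Gamma.coeff M (E (a * b)) := by
  simp [wick, wickRev]

/-- The nested expectation `E[a]^π` of a family `a`, for a partition `π` of a finite set `I` of
positions. It is the product, over the outer blocks `V = {v₁ < ⋯ < v_t}` of `π` in increasing order,
of `E[a_{v₁} e₁ a_{v₂} e₂ ⋯ a_{v_t}]`, where `e_j` is the nested expectation of the restriction of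
`π` to the elements strictly between `v_j` and `v_{j+1}`. In the code `a_{v_t}` carries a factor
too: the nested expectation over the empty set, which is `1`. -/
noncomputable def nestedExp {D M : Type*} [Ring D] [NonUnitalRing M] [Module Dᵐᵒᵖ M]
    (E : M → D) {n : ℕ} (a : Fin n → M) (I : Finset (Fin n)) (π : Finpartition I) : D :=
  ((sortByMax (outerBlocks π)).attach.map fun V =>
    E (nonunitalProd ((V.1.sort (· ≤ ·)).attach.map fun v =>
      MulOpposite.op
        (nestedExp E a (gapInside I V.1 v.1) (π.restrict (Finset.filter_subset _ _))) • a v.1))).prod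
termination_by I.card
decreasing_by
  have hVI : V.1 ⊆ I := by
    have h1 : V.1 ∈ outerBlocks π := by simpa [sortByMax] using V.2
    exact π.le (Finset.mem_filter.1 h1).1
  have hvV : v.1 ∈ V.1 := by simpa using v.2
  refine Finset.card_lt_card (Finset.ssubset_iff_of_subset
    (Finset.filter_subset _ _) |>.2 ⟨v.1, hVI hvV, ?_⟩)
  simp

/-- The recursion that defines `nestedExp`, without the bookkeeping for termination. -/
theorem nestedExp_eq {D M : Type*} [Ring D] [NonUnitalRing M] [Module Dᵐᵒᵖ M]
    (E : M → D) {n : ℕ} (a : Fin n → M) (I : Finset (Fin n)) (π : Finpartition I) :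
    nestedExp E a I π =
      ((sortByMax (outerBlocks π)).map fun V =>
        E (nonunitalProd ((V.sort (· ≤ ·)).map fun v =>
          MulOpposite.op (nestedExp E a (gapInside I V v)
            (π.restrict (Finset.filter_subset _ _))) • a v))).prod := by
  rw [nestedExp]
  congr 1
  refine Eq.trans (List.map_congr_left fun V _ => ?_)
    (List.attach_map_val (f := fun V : Finset (Fin n) => E (nonunitalProd ((V.sort (· ≤ ·)).map fun v =>
      MulOpposite.op (nestedExp E a (gapInside I V v)
        (π.restrict (Finset.filter_subset _ _))) • a v))))
  exact congrArg (fun l => E (nonunitalProd l)) (List.attach_map_val (f := fun v =>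
    MulOpposite.op (nestedExp E a (gapInside I V.1 v)
      (π.restrict (Finset.filter_subset _ _))) • a v))

/-- For a function `F` of lists `[b₁, …, b_ℓ]`, read as elementary tensors `b₁ ⊗ ⋯ ⊗ b_ℓ`, and
`(π, S)` with open blocks `S = {V₁ < ⋯ < V_ℓ}`, the contraction `F(a₁ ⊗ ⋯ ⊗ aₙ)^{(π,S)}`. It is
`F(e₀ b₁ ⊗ ⋯ ⊗ b_ℓ) = e₀ F(b₁ ⊗ ⋯ ⊗ b_ℓ)`. Here `e₀` is the nested expectation of `π` restricted to
the positions before all open blocks, and `b_i` is the product over `v ∈ V_i`, in increasing order,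
of `a_v e_v`, with `e_v` the nested expectation of `π` restricted to the positions strictly between
`v` and the next position that belongs to an open block (or the end). -/
noncomputable def contraction {D M : Type*} [Ring D] [Algebra ℂ D] [NonUnitalRing M]
    [Module D M] [Module Dᵐᵒᵖ M] (E : M → D) (F : List M → Gamma D M) {n : ℕ} (a : Fin n → M)
    (p : Finpartition (Finset.univ : Finset (Fin n)) × Finset (Finset (Fin n))) : Gamma D M :=
  Gamma.coeff M
      (nestedExp E a (gapBefore Finset.univ (p.2.biUnion id))
        (p.1.restrict (Finset.filter_subset _ _))) *
    F ((sortByMax p.2).map fun V =>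
      nonunitalProd ((V.sort (· ≤ ·)).map fun v =>
        MulOpposite.op
          (nestedExp E a (gapAfter Finset.univ (p.2.biUnion id) v)
            (p.1.restrict (Finset.filter_subset _ _))) • a v))

/-- `F` defines, for each `n ≥ 1`, a `D`-bimodule map on the `n`-fold tensor power of `M` over `D`:
it is additive in each argument, balanced over `D` in neighbouring arguments, and compatible with
the left action on the first argument and the right action on the last one. -/
structure IsTensorBimoduleMap {D M : Type*} [Ring D] [Algebra ℂ D] [NonUnitalRing M]
    [Module D M] [Module Dᵐᵒᵖ M] (F : List M → Gamma D M) : Prop where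
  map_add : ∀ (l l' : List M) (a b : M),
    F (l ++ (a + b) :: l') = F (l ++ a :: l') + F (l ++ b :: l')
  balanced : ∀ (l l' : List M) (a b : M) (d : D),
    F (l ++ (MulOpposite.op d • a) :: b :: l') = F (l ++ a :: (d • b) :: l')
  map_left : ∀ (d : D) (a : M) (l : List M), F ((d • a) :: l) = Gamma.coeff M d * F (a :: l)
  map_right : ∀ (l : List M) (a : M) (d : D),
    F (l ++ [MulOpposite.op d • a]) = F (l ++ [a]) * Gamma.coeff M d

/-!
Let `I` be a set of positions and `k` a position after all of `I`. Every incomplete non-crossing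
partition of `insert k I` arises in exactly one way from one, `(π, S)`, of `I`: the position `k` forms
a new block or joins the last block of `S`, and the resulting block is open or closed
(`sum_INCOn_insert`). No other block can be joined, since the block of the last position covers all
blocks that lie between its elements; for the same reason the block without `k` may be declared
open. If the contraction along `(π, S)` is `e F(b₁ ⊗ ⋯ ⊗ b_ℓ)`, then the four choices turn it into
`e F(b₁ ⊗ ⋯ ⊗ b_ℓ ⊗ a)`, `e F(b₁ ⊗ ⋯ ⊗ b_ℓ) ⟨a⟩`, `e F(b₁ ⊗ ⋯ ⊗ b_ℓ a)` and
`e F(b₁ ⊗ ⋯ ⊗ b_{ℓ-1}) ⟨b_ℓ a⟩`, with `a = a_k` (`contractionOn_extOpen`,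
`contractionOn_extClosed`). The reason is that restricting the new partition to `I` gives back `π`, so
the nested expectations over old gaps are the same, and that a nested expectation splits at the block
of its last position (`nestedExp_eq_mul`).

Sums over incomplete partitions can therefore be evaluated one position at a time.

* For `F = W` the four terms add up to `e W(b₁ ⊗ ⋯ ⊗ b_ℓ) X(a)`, by the recursion that defines `W`.
  This is the expansion of a monomial.
* For `F = M` the partial sums over the first `m` positions are completed by Wick products of the
  remaining arguments. The completed sum does not depend on `m`, because of the mirror image
  `wick_cons_cons` of the recursion. It is the Wick product for `m = 0` and the signed sum over
  monomials for `m = n` (`pendingTerm`, `inversionTerm`).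
* For a product of Wick products, the partial sums within one factor are completed by the rest of this
  factor. The completed sum does not depend on the number of positions read, because of the formula
  `wick_append_mul_wick_cons` for `W(⋯ ⊗ b) W(c ⊗ ⋯)` (`productTerm`).
-/

/-! ### The algebra `Γ(M)` and recursions for Wick products -/

section Algebra

variable {D M : Type*} [Ring D] [Algebra ℂ D]

namespace Gamma

variable [AddCommGroup M] [Module D M] [Module Dᵐᵒᵖ M]

theorem coeff_add (d e : D) : coeff M (d + e) = coeff M d + coeff M e := by
  have := RingQuot.mkAlgHom_rel ℂ (GammaRel.coeff_add (M := M) d e)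
  rw [map_add] at this
  exact this

theorem coeff_mul (d e : D) : coeff M (d * e) = coeff M d * coeff M e := by
  have := RingQuot.mkAlgHom_rel ℂ (GammaRel.coeff_mul (M := M) d e)
  rw [map_mul] at this
  exact this

theorem coeff_algebraMap (z : ℂ) :
    coeff M (algebraMap ℂ D z) = algebraMap ℂ (Gamma D M) z := by
  have := RingQuot.mkAlgHom_rel ℂ (GammaRel.coeff_algebraMap (D := D) (M := M) z)
  rw [AlgHom.commutes] at this
  exact this

theorem coeff_one : coeff M (1 : D) = 1 := by
  simpa using coeff_algebraMap (D := D) (M := M) 1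

theorem coeff_zero : coeff M (0 : D) = 0 := by
  simpa using coeff_algebraMap (D := D) (M := M) 0

theorem X_bimodule (d₁ d₂ d₃ d₄ : D) (a b : M) :
    X D (d₁ • (MulOpposite.op d₂ • a) + d₃ • (MulOpposite.op d₄ • b)) =
      coeff M d₁ * X D a * coeff M d₂ + coeff M d₃ * X D b * coeff M d₄ := by
  have := RingQuot.mkAlgHom_rel ℂ (GammaRel.X_bimodule d₁ d₂ d₃ d₄ a b)
  simp only [map_mul, map_add] at this
  exact this

theorem X_add (a b : M) : X D (a + b) = X D a + X D b := by
  simpa [coeff_one] using X_bimodule (D := D) 1 1 1 1 a b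

theorem X_smul (d : D) (a : M) : X D (d • a) = coeff M d * X D a := by
  simpa [coeff_one, coeff_zero] using X_bimodule d 1 0 0 a 0

theorem X_op_smul (d : D) (a : M) :
    X D (MulOpposite.op d • a) = X D a * coeff M d := by
  simpa [coeff_one, coeff_zero] using X_bimodule 1 d 0 0 a 0

end Gamma

open Gamma

variable [NonUnitalRing M] [Module D M] [Module Dᵐᵒᵖ M]

theorem monomialProd_append (l l' : List M) :
    monomialProd D (l ++ l') = monomialProd D l * monomialProd D l' := by
  simp [monomialProd]

theorem monomialProd_singleton (a : M) : monomialProd D [a] = X D a := by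
  simp [monomialProd]

theorem wickRev_nil (E : M → D) : wickRev E ([] : List M) = 1 := by
  rw [wickRev]

theorem wickRev_singleton (E : M → D) (a : M) : wickRev E [a] = X D a - coeff M (E a) := by
  rw [wickRev]

theorem wickRev_cons_cons (E : M → D) (a b : M) (l : List M) :
    wickRev E (b :: a :: l) =
      wickRev E (a :: l) * X D b - wickRev E (a :: l) * coeff M (E b)
        - wickRev E ((a * b) :: l) - wickRev E l * coeff M (E (a * b)) := by
  rw [wickRev]

theorem wickRev_add (E : M → D) (hadd : ∀ a b, E (a + b) = E a + E b) (a b : M) :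
    ∀ l l' : List M, wickRev E (l ++ (a + b) :: l') =
      wickRev E (l ++ a :: l') + wickRev E (l ++ b :: l')
  | [], [] => by
    simp only [List.nil_append, wickRev_singleton, X_add, hadd, coeff_add]; abel
  | [], c :: l' => by
    have h := wickRev_add E hadd (c * a) (c * b) [] l'
    simp only [List.nil_append] at h ⊢
    simp only [wickRev_cons_cons, mul_add, h, X_add, hadd, coeff_add]; abel
  | [y], l' => by
    have h := wickRev_add E hadd a b [] l'
    have h' := wickRev_add E hadd (a * y) (b * y) [] l'
    simp only [List.nil_append, List.cons_append] at h h' ⊢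
    simp only [wickRev_cons_cons, add_mul, mul_add, h, h', hadd, coeff_add]; abel
  | y :: z :: l, l' => by
    have h := wickRev_add E hadd a b (z :: l) l'
    have h' := wickRev_add E hadd a b ((z * y) :: l) l'
    have h'' := wickRev_add E hadd a b l l'
    simp only [List.cons_append] at h h' ⊢
    simp only [wickRev_cons_cons, h, h', h'', add_mul]; abel
termination_by l l' => l.length + l'.length

section Bimodule

variable (E : M → D)

/-- In `wickRev` the last tensor factor is the head of the list, so this is the right `D`-linearity
of Wick products. -/
theorem wickRev_op_smul [SMulCommClass Dᵐᵒᵖ M M]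
    (hE : ∀ (a : M) (d : D), E (MulOpposite.op d • a) = E a * d) (d : D) :
    ∀ (l : List M) (a : M), wickRev E (MulOpposite.op d • a :: l) =
      wickRev E (a :: l) * coeff M d
  | [], a => by
    simp only [wickRev_singleton, X_op_smul, hE, coeff_mul, sub_mul]
  | c :: l, a => by
    simp only [wickRev_cons_cons, mul_smul_comm, wickRev_op_smul hE d l (c * a), X_op_smul, hE,
      coeff_mul, sub_mul, mul_assoc]

/-- The first tensor factor is the last entry of the reversed list, so this is the left
`D`-linearity of Wick products. -/
theorem wickRev_smul [IsScalarTower D M M]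
    (hE : ∀ (d : D) (a : M), E (d • a) = d * E a) (d : D) :
    ∀ (l : List M) (a : M), wickRev E (l ++ [d • a]) = coeff M d * wickRev E (l ++ [a])
  | [], a => by
    simp only [List.nil_append, wickRev_singleton, X_smul, hE, coeff_mul, mul_sub]
  | [y], a => by
    simp only [List.cons_append, List.nil_append, wickRev_cons_cons, wickRev_singleton,
      smul_mul_assoc, X_smul, hE, coeff_mul, mul_sub, sub_mul, mul_assoc, wickRev_nil, one_mul]
  | y :: z :: l, a => by
    have h := wickRev_smul hE d (z :: l) a
    have h' := wickRev_smul hE d ((z * y) :: l) a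
    have h'' := wickRev_smul hE d l a
    simp only [List.cons_append] at h h' ⊢
    simp only [wickRev_cons_cons, h, h', h'', mul_sub, mul_assoc]
termination_by l => l.length

theorem wickRev_balanced [IsScalarTower D M M] [SMulCommClass Dᵐᵒᵖ M M]
    (hmid : ∀ (a b : M) (d : D), (MulOpposite.op d • a) * b = a * (d • b))
    (hE_left : ∀ (d : D) (a : M), E (d • a) = d * E a)
    (hE_right : ∀ (a : M) (d : D), E (MulOpposite.op d • a) = E a * d) (d : D) (a : M)
    (l' : List M) :
    ∀ (l : List M) (b : M), wickRev E (l ++ b :: MulOpposite.op d • a :: l') =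
      wickRev E (l ++ (d • b) :: a :: l')
  | [], b => by
    simp only [List.nil_append, wickRev_cons_cons, wickRev_op_smul E hE_right, X_smul, hE_left,
      coeff_mul, mul_assoc, hmid]
  | [y], b => by
    have h := wickRev_balanced hmid hE_left hE_right d a l' [] b
    have h' := wickRev_balanced hmid hE_left hE_right d a l' [] (b * y)
    simp only [List.cons_append, List.nil_append] at h h' ⊢
    rw [wickRev_cons_cons E b y, wickRev_cons_cons E (d • b) y, h, smul_mul_assoc, ← h',
      wickRev_op_smul E hE_right]
    simp only [hE_left, coeff_mul, mul_assoc]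
  | y :: z :: l, b => by
    have h := wickRev_balanced hmid hE_left hE_right d a l' (z :: l) b
    have h' := wickRev_balanced hmid hE_left hE_right d a l' ((z * y) :: l) b
    have h'' := wickRev_balanced hmid hE_left hE_right d a l' l b
    simp only [List.cons_append] at h h' ⊢
    simp only [wickRev_cons_cons, h, h', h'']
termination_by l => l.length

theorem isTensorBimoduleMap_wick [IsScalarTower D M M] [SMulCommClass Dᵐᵒᵖ M M]
    (hmid : ∀ (a b : M) (d : D), (MulOpposite.op d • a) * b = a * (d • b))
    (hadd : ∀ a b, E (a + b) = E a + E b)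
    (hE_left : ∀ (d : D) (a : M), E (d • a) = d * E a)
    (hE_right : ∀ (a : M) (d : D), E (MulOpposite.op d • a) = E a * d) :
    IsTensorBimoduleMap (D := D) (wick E) where
  map_add l l' a b := by
    simpa [wick] using wickRev_add E hadd a b l'.reverse l.reverse
  balanced l l' a b d := by
    simpa [wick] using wickRev_balanced E hmid hE_left hE_right d a l.reverse l'.reverse b
  map_left d a l := by
    simpa [wick] using wickRev_smul E hE_left d l.reverse a
  map_right l a d := by
    simpa [wick] using wickRev_op_smul E hE_right d l.reverse a

end Bimodule

/-- The mirror image of the four-term recursion: the Wick products can be built up from the left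
end as well. -/
theorem wick_cons_cons (E : M → D) (a b : M) (l : List M) :
    wick E (a :: b :: l) =
      X D a * wick E (b :: l) - coeff M (E a) * wick E (b :: l)
        - wick E ((a * b) :: l) - coeff M (E (a * b)) * wick E l := by
  have key : ∀ l : List M, wickRev E (l ++ [b, a]) =
      X D a * wickRev E (l ++ [b]) - coeff M (E a) * wickRev E (l ++ [b])
        - wickRev E (l ++ [a * b]) - coeff M (E (a * b)) * wickRev E l := by
    intro l
    induction hn : l.length using Nat.strong_induction_on generalizing l b with
    | _ n ih =>
      match l, hn with
      | [], _ =>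
        simp only [List.nil_append, wickRev_cons_cons, wickRev_singleton, wickRev_nil]
        noncomm_ring
      | [y], hn =>
        have h := ih 0 (by simp at hn; omega) b [] rfl
        have h' := ih 0 (by simp at hn; omega) (b * y) [] rfl
        simp only [List.nil_append, List.cons_append] at h h' ⊢
        rw [wickRev_cons_cons, h, h', wickRev_cons_cons E b y, wickRev_cons_cons E (a * b) y]
        simp only [wickRev_singleton, wickRev_nil, mul_assoc]
        noncomm_ring
      | y :: z :: l, hn =>
        have h := ih (z :: l).length (by simp at hn ⊢; omega) b (z :: l) rfl
        have h' := ih ((z * y) :: l).length (by simp at hn ⊢; omega) b ((z * y) :: l) rfl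
        have h'' := ih l.length (by simp at hn ⊢; omega) b l rfl
        simp only [List.cons_append] at h h' ⊢
        simp only [wickRev_cons_cons, h, h', h'']
        noncomm_ring
  simpa [wick] using key l.reverse

/-- The product of two Wick products. The last argument `b` of the first factor and the first
argument `c` of the second one either stay apart, or merge into one argument, or merge into an
expectation, after which the shortened second factor meets the shortened first one. -/
theorem wick_append_mul_wick_cons (E : M → D) (l' : List M) :
    ∀ (l : List M) (b c : M), wick E (l ++ [b]) * wick E (c :: l') =
      wick E (l ++ b :: c :: l') + wick E (l ++ (b * c) :: l') +
        wick E l * coeff M (E (b * c)) * wick E l' := by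
  induction hn : l'.length using Nat.strong_induction_on generalizing l' with
  | _ n ih =>
    intro l b c
    match l', hn with
    | [], _ =>
      rw [wick_append E l b c, wick_singleton, wick_nil]
      noncomm_ring
    | c' :: l', hn =>
      have hn' : l'.length < n := by simp at hn; omega
      have h₁ := ih _ hn' l' rfl (l ++ [b]) c c'
      have h₂ := ih _ hn' l' rfl l (b * c) c'
      have h₃ := ih _ hn' l' rfl l b (c * c')
      have h₄ := wick_append E l b c
      simp only [List.append_assoc, List.cons_append, List.nil_append] at h₁
      have h₅ : wick E (l ++ [b]) * X D c = wick E (l ++ [b, c]) + wick E (l ++ [b]) * coeff M (E c)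
          + wick E (l ++ [b * c]) + wick E l * coeff M (E (b * c)) := by
        rw [h₄]; abel
      -- peel `c` off the second factor on the left, absorb it into the first factor by the recursion,
      -- and apply the induction hypothesis to the three resulting products
      rw [wick_cons_cons E c c' l']
      simp only [mul_sub, ← mul_assoc] at h₁ h₂ h₃ ⊢
      rw [h₅, h₃]
      simp only [add_mul]
      rw [h₁, h₂]
      abel

end Algebra

/-! ### Nested expectations over non-crossing partitions -/

section Sorting

variable {n : ℕ}

theorem mem_sortByMax {C : Finset (Finset (Fin n))} {U : Finset (Fin n)} :
    U ∈ sortByMax C ↔ U ∈ C := by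
  simp [sortByMax]

theorem sortByMax_empty : sortByMax (∅ : Finset (Finset (Fin n))) = [] := by
  simp [sortByMax]

/-- If the sets in `insert V C` have different maxima and `V` has the largest one, then `V` comes
last in the order by maxima. -/
theorem sortByMax_insert {C : Finset (Finset (Fin n))} {V : Finset (Fin n)}
    (hinj : ∀ U ∈ C, ∀ W ∈ C, U.max = W.max → U = W) (hV : ∀ U ∈ C, U.max < V.max) :
    sortByMax (insert V C) = sortByMax C ++ [V] := by
  have hVC : V ∉ C := fun h => lt_irrefl _ (hV V h)
  have hsort : ∀ C : Finset (Finset (Fin n)), (sortByMax C).Pairwise fun U W => U.max ≤ W.max := by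
    intro C
    have := List.pairwise_mergeSort (le := fun U W : Finset (Fin n) => decide (U.max ≤ W.max))
      (fun a b c h h' => by
        rw [decide_eq_true_eq] at h h' ⊢; exact h.trans h')
      (fun a b => by
        rw [Bool.or_eq_true, decide_eq_true_eq, decide_eq_true_eq]; exact le_total _ _) C.toList
    simpa [sortByMax] using this
  have hp : (sortByMax (insert V C)).Perm (sortByMax C ++ [V]) := by
    refine (List.mergeSort_perm _ _).trans ((Finset.toList_insert hVC).trans ?_)
    refine List.Perm.trans ?_ List.perm_append_comm
    simpa [sortByMax] using (List.mergeSort_perm C.toList _).symm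
  refine hp.eq_of_pairwise ?_ (hsort _) ?_
  · intro U W hU hW h₁ h₂
    have hmax := le_antisymm h₁ h₂
    simp only [mem_sortByMax, Finset.mem_insert] at hU
    simp only [List.mem_append, mem_sortByMax, List.mem_singleton] at hW
    rcases hU with rfl | hU <;> rcases hW with hW | rfl
    · exact absurd hmax (hV W hW).ne'
    · rfl
    · exact hinj U hU W hW hmax
    · exact absurd hmax (hV U hU).ne
  · rw [List.pairwise_append]
    refine ⟨hsort _, List.pairwise_singleton _ _, fun U hU W hW => ?_⟩
    rw [List.mem_singleton.1 hW]
    exact (hV U (mem_sortByMax.1 hU)).le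

/-- Sorting a set to which a new largest element is added. -/
theorem sort_insert_of_forall_lt {V : Finset (Fin n)} {k : Fin n} (hk : ∀ x ∈ V, x < k) :
    (insert k V).sort (· ≤ ·) = V.sort (· ≤ ·) ++ [k] := by
  have hkV : k ∉ V := fun h => lt_irrefl _ (hk k h)
  have hp : ((insert k V).sort (· ≤ ·)).Perm (V.sort (· ≤ ·) ++ [k]) := by
    refine (List.perm_ext_iff_of_nodup (Finset.sort_nodup _ _) ?_).2 fun x => by simp [or_comm]
    refine (Finset.sort_nodup _ _).append (List.nodup_singleton k) ?_
    simpa using hkV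
  refine hp.eq_of_pairwise' (Finset.pairwise_sort _ _) ?_
  rw [List.pairwise_append]
  refine ⟨Finset.pairwise_sort _ _, List.pairwise_singleton _ _, fun x hx y hy => ?_⟩
  rw [List.mem_singleton.1 hy]
  exact (hk x (by simpa using hx)).le

end Sorting

section Product

variable {M : Type*} [NonUnitalRing M]

theorem nonunitalProd_append_singleton {l : List M} (hl : l ≠ []) (a : M) :
    nonunitalProd (l ++ [a]) = nonunitalProd l * a := by
  match l, hl with
  | [b], _ => simp [nonunitalProd]
  | b :: c :: l, _ =>
    have := nonunitalProd_append_singleton (List.cons_ne_nil c l) a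
    simp only [List.cons_append, nonunitalProd] at this ⊢
    rw [this, mul_assoc]

theorem nonunitalProd_append_op_smul {D : Type*} [Ring D] [Module Dᵐᵒᵖ M]
    [SMulCommClass Dᵐᵒᵖ M M] (l : List M) (a : M) (d : D) :
    nonunitalProd (l ++ [MulOpposite.op d • a]) =
      MulOpposite.op d • nonunitalProd (l ++ [a]) := by
  rcases eq_or_ne l [] with rfl | hl
  · rfl
  · rw [nonunitalProd_append_singleton hl, nonunitalProd_append_singleton hl, mul_smul_comm]

end Product

section Restrict

variable {n : ℕ} {I J : Finset (Fin n)}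

theorem mem_parts_restrict (π : Finpartition I) (h : J ⊆ I) {U : Finset (Fin n)} :
    U ∈ (π.restrict h).parts ↔ U.Nonempty ∧ ∃ W ∈ π.parts, W ∩ J = U := by
  simp [Finpartition.restrict, Finset.nonempty_iff_ne_empty]

/-- Restrictions compose without any condition on the blocks, so a nested expectation over a gap
inside another gap can be taken with respect to the original partition. -/
theorem restrict_restrict (π : Finpartition I) {K : Finset (Fin n)} (h : J ⊆ I) (h' : K ⊆ J) :
    (π.restrict h).restrict h' = π.restrict (h'.trans h) := by
  ext U
  simp only [mem_parts_restrict]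
  refine and_congr_right fun hU => ⟨?_, ?_⟩
  · rintro ⟨_, ⟨-, W, hW, rfl⟩, rfl⟩
    exact ⟨W, hW, by rw [Finset.inter_assoc, Finset.inter_eq_right.2 h']⟩
  · rintro ⟨W, hW, rfl⟩
    have h₁ : W ∩ J ∩ K = W ∩ K := by rw [Finset.inter_assoc, Finset.inter_eq_right.2 h']
    refine ⟨W ∩ J, ⟨?_, W, hW, rfl⟩, h₁⟩
    rw [← h₁] at hU
    exact hU.mono Finset.inter_subset_left

theorem restrict_self (π : Finpartition I) (h : I ⊆ I) : π.restrict h = π := by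
  ext U
  simp only [mem_parts_restrict]
  constructor
  · rintro ⟨-, W, hW, rfl⟩
    rwa [Finset.inter_eq_left.2 (π.subset hW)]
  · exact fun hU => ⟨π.nonempty_of_mem_parts hU, U, hU, Finset.inter_eq_left.2 (π.subset hU)⟩

theorem IsNoncrossing.restrict {π : Finpartition I} (hπ : IsNoncrossing π) (h : J ⊆ I) :
    IsNoncrossing (π.restrict h) := by
  intro U hU V hV hUV i hi k hk j hj l hl
  obtain ⟨-, U, hU', rfl⟩ := (mem_parts_restrict π h).1 hU
  obtain ⟨-, V, hV', rfl⟩ := (mem_parts_restrict π h).1 hV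
  simp only [Finset.mem_inter] at hi hk hj hl
  exact hπ U hU' V hV' (fun e => hUV (by rw [e])) i hi.1 k hk.1 j hj.1 l hl.1

theorem mem_outerBlocks {π : Finpartition I} {U : Finset (Fin n)} :
    U ∈ outerBlocks π ↔ U ∈ π.parts ∧
      ∀ V ∈ π.parts, V ≠ U → ∀ x ∈ U, ∀ i ∈ V, ∀ j ∈ V, ¬ (i < x ∧ x < j) := by
  simp [outerBlocks]

theorem eq_of_max_eq {π : Finpartition I} {U V : Finset (Fin n)} (hU : U ∈ π.parts)
    (hV : V ∈ π.parts) (h : U.max = V.max) : U = V := by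
  obtain ⟨x, hx⟩ := Finset.max_of_nonempty (π.nonempty_of_mem_parts hU)
  exact π.eq_of_mem_parts hU hV (Finset.mem_of_max hx) (Finset.mem_of_max (h ▸ hx))

/-- Two outer blocks do not overlap: they are separated, in the order of their maxima. -/
theorem forall_lt_of_max_le {π : Finpartition I} {U V : Finset (Fin n)}
    (hU : U ∈ outerBlocks π) (hV : V ∈ outerBlocks π) (hUV : U ≠ V) (h : U.max ≤ V.max) :
    ∀ x ∈ U, ∀ y ∈ V, x < y := by
  intro x hx y hy
  rw [mem_outerBlocks] at hU hV
  have hne : ∀ z ∈ U, ∀ w ∈ V, z ≠ w := by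
    rintro z hz w hw rfl
    exact hUV (π.eq_of_mem_parts hU.1 hV.1 hz hw)
  obtain ⟨m, hm⟩ := Finset.max_of_nonempty ⟨y, hy⟩
  have hmV := Finset.mem_of_max hm
  have hxm : x < m := lt_of_le_of_ne
    (WithBot.coe_le_coe.1 ((Finset.le_max hx).trans (h.trans hm.le))) (hne x hx m hmV)
  by_contra hyx
  exact hU.2 V hV.1 hUV.symm x hx y hy m hmV ⟨lt_of_le_of_ne (not_lt.1 hyx) (hne x hx y hy).symm, hxm⟩

end Restrict

section NestedExp

variable {D M : Type*} [Ring D] [NonUnitalRing M] [Module Dᵐᵒᵖ M] {n : ℕ}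

theorem nestedExp_restrict_restrict (E : M → D) (a : Fin n → M) {I J K : Finset (Fin n)}
    (π : Finpartition I) (h : J ⊆ I) (h' : K ⊆ J) :
    nestedExp E a K ((π.restrict h).restrict h') = nestedExp E a K (π.restrict (h'.trans h)) := by
  rw [restrict_restrict]

/-- If `π` is the restriction of `π'`, then `π` and `π'` have the same nested expectations over sets
of positions inside the domain of `π`. -/
theorem nestedExp_restrict_congr (E : M → D) (a : Fin n → M) {I I' J J' : Finset (Fin n)}
    {π : Finpartition I} {π' : Finpartition I'} {hI : I ⊆ I'} (hπ : π'.restrict hI = π)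
    (e : J' = J) (h : J ⊆ I) (h' : J' ⊆ I') :
    nestedExp E a J' (π'.restrict h') = nestedExp E a J (π.restrict h) := by
  subst e hπ
  rw [restrict_restrict]

theorem nestedExp_empty (E : M → D) (a : Fin n → M) {I : Finset (Fin n)} (hI : I = ∅)
    (π : Finpartition I) : nestedExp E a I π = 1 := by
  subst hI
  have : outerBlocks π = ∅ := by
    rw [Finset.eq_empty_iff_forall_notMem]
    intro U hU
    have hU := (mem_outerBlocks.1 hU).1
    exact π.ne_empty hU (Finset.subset_empty.1 (π.subset hU))
  rw [nestedExp_eq, this, sortByMax_empty]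
  rfl

/-- The block `V` of the largest position covers everything after its first element, so the other
outer blocks are those of the restriction to the positions before `V`. -/
theorem outerBlocks_eq_insert {I : Finset (Fin n)} {π : Finpartition I} (hπ : IsNoncrossing π)
    {V : Finset (Fin n)} (hV : V ∈ π.parts) {m : Fin n} (hm : m ∈ V) (hmax : ∀ x ∈ I, x ≤ m) :
    outerBlocks π = insert V
      (outerBlocks (π.restrict (b := gapBefore I V) (Finset.filter_subset _ _))) := by
  set B := gapBefore I V with hB
  have memB : ∀ x, x ∈ B ↔ x ∈ I ∧ ∀ v ∈ V, x < v := fun x => by simp [hB, gapBefore]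
  have hVI : V ⊆ I := π.subset hV
  have hne : ∀ W ∈ π.parts, W ≠ V → ∀ x ∈ W, ∀ v ∈ V, x ≠ v := by
    rintro W hW hWV x hx v hv rfl
    exact hWV (π.eq_of_mem_parts hW hV hx hv)
  have hlt : ∀ W ∈ π.parts, W ≠ V → ∀ x ∈ W, x < m := fun W hW hWV x hx =>
    lt_of_le_of_ne (hmax x (π.subset hW hx)) (hne W hW hWV x hx m hm)
  -- a block that begins before `V` ends before `V`, as it would cross `V` otherwise
  have hsub : ∀ W ∈ π.parts, W ≠ V → ∀ x ∈ W, x ∈ B → W ⊆ B := by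
    intro W hW hWV x hx hxB y hy
    refine (memB y).2 ⟨π.subset hW hy, fun v hv => ?_⟩
    by_contra hyv
    exact hπ W hW V hV hWV x hx y hy v hv m hm ⟨((memB x).1 hxB).2 v hv,
      lt_of_le_of_ne (not_lt.1 hyv) (hne W hW hWV y hy v hv).symm, hlt W hW hWV y hy⟩
  ext U
  rw [Finset.mem_insert, mem_outerBlocks, mem_outerBlocks]
  constructor
  · rintro ⟨hU, hout⟩
    rcases eq_or_ne U V with rfl | hUV
    · exact Or.inl rfl
    have hUB : U ⊆ B := fun x hx => (memB x).2 ⟨π.subset hU hx, fun v hv => by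
      by_contra hxv
      exact hout V hV hUV.symm x hx v hv m hm
        ⟨lt_of_le_of_ne (not_lt.1 hxv) (hne U hU hUV x hx v hv).symm, hlt U hU hUV x hx⟩⟩
    refine Or.inr ⟨(mem_parts_restrict _ _).2
      ⟨π.nonempty_of_mem_parts hU, U, hU, Finset.inter_eq_left.2 hUB⟩, ?_⟩
    intro W hW hWU x hx i hi j hj
    obtain ⟨-, W, hW', rfl⟩ := (mem_parts_restrict _ _).1 hW
    refine hout W hW' ?_ x hx i (Finset.mem_inter.1 hi).1 j (Finset.mem_inter.1 hj).1
    rintro rfl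
    exact hWU (Finset.inter_eq_left.2 hUB)
  · rintro (rfl | ⟨hU, hout⟩)
    · refine ⟨hV, fun W hW hWU x hx i hi j hj hij => ?_⟩
      exact hπ W hW U hV hWU i hi j hj x hx m hm ⟨hij.1, hij.2, hlt W hW hWU j hj⟩
    · obtain ⟨⟨y, hy⟩, W, hW, rfl⟩ := (mem_parts_restrict _ _).1 hU
      rw [Finset.mem_inter] at hy
      have hWV : W ≠ V := by
        rintro rfl
        exact lt_irrefl _ (((memB y).1 hy.2).2 y hy.1)
      have hWB := hsub W hW hWV y hy.1 hy.2
      rw [Finset.inter_eq_left.2 hWB] at hout ⊢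
      refine ⟨hW, fun T hT hTW x hx i hi j hj hij => ?_⟩
      have hxB := (memB x).1 (hWB hx)
      rcases eq_or_ne T V with rfl | hTV
      · exact lt_asymm hij.1 (hxB.2 i hi)
      have hTB := hsub T hT hTV i hi
        ((memB i).2 ⟨π.subset hT hi, fun v hv => hij.1.trans (hxB.2 v hv)⟩)
      exact hout T ((mem_parts_restrict _ _).2
        ⟨π.nonempty_of_mem_parts hT, T, hT, Finset.inter_eq_left.2 hTB⟩) hTW x hx i hi j hj hij

/-- The block `V` of the largest position splits off a nested expectation: it is an outer block, the
blocks before it make up the first factor, and all other blocks are nested inside it. -/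
theorem nestedExp_eq_mul (E : M → D) (a : Fin n → M) {I : Finset (Fin n)} {π : Finpartition I}
    (hπ : IsNoncrossing π) {V : Finset (Fin n)} (hV : V ∈ π.parts) {m : Fin n} (hm : m ∈ V)
    (hmax : ∀ x ∈ I, x ≤ m) :
    nestedExp E a I π =
      nestedExp E a (gapBefore I V) (π.restrict (Finset.filter_subset _ _)) *
        E (nonunitalProd ((V.sort (· ≤ ·)).map fun v =>
          MulOpposite.op (nestedExp E a (gapInside I V v)
            (π.restrict (Finset.filter_subset _ _))) • a v)) := by
  have hout := outerBlocks_eq_insert hπ hV hm hmax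
  have hVout : V ∈ outerBlocks π := by rw [hout]; exact Finset.mem_insert_self _ _
  have hBout : ∀ U ∈ outerBlocks (π.restrict (b := gapBefore I V) (Finset.filter_subset _ _)),
      U ∈ outerBlocks π ∧ U.Nonempty ∧ ∀ x ∈ U, x ∈ I ∧ ∀ v ∈ V, x < v := by
    intro U hU
    refine ⟨by rw [hout]; exact Finset.mem_insert_of_mem hU,
      Finpartition.nonempty_of_mem_parts _ (mem_outerBlocks.1 hU).1, fun x hx => ?_⟩
    have := Finpartition.subset _ (mem_outerBlocks.1 hU).1 hx
    simpa [gapBefore] using this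
  rw [nestedExp_eq, hout, sortByMax_insert, List.map_append, List.prod_append,
    nestedExp_eq E a (gapBefore I V)]
  · congr 1
    · refine congrArg List.prod (List.map_congr_left fun U hU => ?_)
      obtain ⟨-, -, hUV⟩ := hBout U (mem_sortByMax.1 hU)
      refine congrArg (fun l => E (nonunitalProd l)) (List.map_congr_left fun v hv => ?_)
      refine congrArg (fun d => MulOpposite.op d • a v)
        (nestedExp_restrict_congr E a (π' := π) rfl ?_ _ _)
      ext x
      simp only [gapInside, gapBefore, Finset.mem_filter]
      constructor
      · rintro ⟨hx, hvx, ⟨w, hw, hxw⟩, h⟩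
        exact ⟨⟨hx, fun y hy => hxw.trans ((hUV w hw).2 y hy)⟩, hvx, ⟨w, hw, hxw⟩, h⟩
      · rintro ⟨⟨hx, -⟩, h⟩
        exact ⟨hx, h⟩
    · simp
  · intro U hU W hW
    exact eq_of_max_eq (mem_outerBlocks.1 (hBout U hU).1).1 (mem_outerBlocks.1 (hBout W hW).1).1
  · intro U hU
    obtain ⟨-, hne, hUV⟩ := hBout U hU
    obtain ⟨u, hu⟩ := Finset.max_of_nonempty hne
    rw [hu]
    exact lt_of_lt_of_le (WithBot.coe_lt_coe.2 ((hUV u (Finset.mem_of_max hu)).2 m hm))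
      (Finset.le_max hm)

end NestedExp

/-! ### Partitions with one more position -/

section Extension

variable {n : ℕ} {I : Finset (Fin n)} {k : Fin n}

/-- Incomplete non-crossing partitions of a finite set `I` of positions: pairs `(π, S)` of a
non-crossing partition `π` of `I` and a set `S` of outer blocks of `π`. -/
def INCOn (I : Finset (Fin n)) : Finset (Finpartition I × Finset (Finset (Fin n))) :=
  Finset.univ.filter fun p => IsNoncrossing p.1 ∧ p.2 ⊆ outerBlocks p.1

theorem mem_INCOn {p : Finpartition I × Finset (Finset (Fin n))} :
    p ∈ INCOn I ↔ IsNoncrossing p.1 ∧ p.2 ⊆ outerBlocks p.1 := by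
  simp [INCOn]

/-- The block with the largest maximum, `∅` if there is no block. -/
noncomputable def topBlock (S : Finset (Finset (Fin n))) : Finset (Fin n) :=
  (sortByMax S).getLastD ∅

theorem topBlock_empty : topBlock (∅ : Finset (Finset (Fin n))) = ∅ := by
  simp [topBlock, sortByMax_empty]

theorem mem_parts_of_mem_INCOn {p : Finpartition I × Finset (Finset (Fin n))}
    (hp : p ∈ INCOn I) {U : Finset (Fin n)} (hU : U ∈ p.2) : U ∈ p.1.parts :=
  (mem_outerBlocks.1 ((mem_INCOn.1 hp).2 hU)).1

theorem sortByMax_eq_append {p : Finpartition I × Finset (Finset (Fin n))} (hp : p ∈ INCOn I)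
    {V : Finset (Fin n)} (hV : V ∈ p.2) (hmax : ∀ U ∈ p.2, U.max ≤ V.max) :
    sortByMax p.2 = sortByMax (p.2.erase V) ++ [V] := by
  conv_lhs => rw [← Finset.insert_erase hV]
  refine sortByMax_insert (fun U hU W hW => ?_) fun U hU => ?_
  · exact eq_of_max_eq (mem_parts_of_mem_INCOn hp (Finset.mem_of_mem_erase hU))
      (mem_parts_of_mem_INCOn hp (Finset.mem_of_mem_erase hW))
  · refine lt_of_le_of_ne (hmax U (Finset.mem_of_mem_erase hU)) fun h => ?_
    exact Finset.ne_of_mem_erase hU (eq_of_max_eq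
      (mem_parts_of_mem_INCOn hp (Finset.mem_of_mem_erase hU)) (mem_parts_of_mem_INCOn hp hV) h)

theorem topBlock_eq {p : Finpartition I × Finset (Finset (Fin n))} (hp : p ∈ INCOn I)
    {V : Finset (Fin n)} (hV : V ∈ p.2) (hmax : ∀ U ∈ p.2, U.max ≤ V.max) :
    topBlock p.2 = V := by
  rw [topBlock, sortByMax_eq_append hp hV hmax]
  simp

theorem topBlock_spec {p : Finpartition I × Finset (Finset (Fin n))} (hp : p ∈ INCOn I)
    (hS : p.2.Nonempty) : topBlock p.2 ∈ p.2 ∧ ∀ U ∈ p.2, U.max ≤ (topBlock p.2).max := by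
  obtain ⟨V, hV, hmax⟩ := Finset.exists_max_image p.2 Finset.max hS
  rw [topBlock_eq hp hV hmax]
  exact ⟨hV, hmax⟩

/-- The partition of `insert k I` in which the new position `k` joins the block `V` of `π`, or forms
a block of its own if `V` is not a block of `π`. -/
def adjoin (π : Finpartition I) (hk : ∀ x ∈ I, x < k) (V : Finset (Fin n)) :
    Finpartition (insert k I) :=
  -- the fallback `∅` makes the definition total in `V`
  let V₀ := if V ∈ π.parts then V else ∅
  have hV₀ : V₀ = ∅ ∨ V₀ ∈ π.parts := by
    simp only [V₀]
    split_ifs with h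
    exacts [Or.inr h, Or.inl rfl]
  have hkI : k ∉ I := fun h => lt_irrefl _ (hk k h)
  have hsub : V₀ ⊆ I := by
    rcases hV₀ with h | h
    · rw [h]; exact Finset.empty_subset _
    · exact π.subset h
  Finpartition.ofExistsUnique (insert (insert k V₀) (π.parts.erase V₀))
    (by
      intro U hU
      rcases Finset.mem_insert.1 hU with rfl | hU
      · exact Finset.insert_subset_insert _ hsub
      · exact (π.subset (Finset.mem_of_mem_erase hU)).trans (Finset.subset_insert _ _))
    (by
      intro x hx
      have hkU : ∀ U ∈ π.parts, k ∉ U := fun U hU h => hkI (π.subset hU h)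
      by_cases hxV : x ∈ insert k V₀
      · refine ⟨insert k V₀, ⟨Finset.mem_insert_self _ _, hxV⟩, ?_⟩
        rintro U ⟨hU, hxU⟩
        rcases Finset.mem_insert.1 hU with rfl | hU
        · rfl
        obtain ⟨hUV, hUπ⟩ := Finset.mem_erase.1 hU
        rcases Finset.mem_insert.1 hxV with rfl | hxV
        · exact absurd hxU (hkU U hUπ)
        · rcases hV₀ with h | h
          · rw [h] at hxV; simp at hxV
          · exact absurd (π.eq_of_mem_parts hUπ h hxU hxV) hUV
      · rw [Finset.mem_insert, not_or] at hxV
        have hxI := (Finset.mem_insert.1 hx).resolve_left hxV.1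
        obtain ⟨U, hU, hxU⟩ := π.exists_mem hxI
        refine ⟨U, ⟨Finset.mem_insert_of_mem (Finset.mem_erase.2 ⟨?_, hU⟩), hxU⟩, ?_⟩
        · rintro rfl
          exact hxV.2 hxU
        · rintro W ⟨hW, hxW⟩
          rcases Finset.mem_insert.1 hW with rfl | hW
          · exact absurd hxW (by simp [hxV.1, hxV.2])
          · exact π.eq_of_mem_parts (Finset.mem_of_mem_erase hW) hU hxW hxU)
    (by
      intro h
      rcases Finset.mem_insert.1 h with h | h
      · exact Finset.insert_ne_empty _ _ h.symm
      · exact π.empty_notMem_parts (Finset.mem_of_mem_erase h))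

theorem parts_adjoin {π : Finpartition I} (hk : ∀ x ∈ I, x < k) {V : Finset (Fin n)}
    (hV : V = ∅ ∨ V ∈ π.parts) :
    (adjoin π hk V).parts = insert (insert k V) (π.parts.erase V) := by
  have : (if V ∈ π.parts then V else ∅) = V := by
    split_ifs with h
    · rfl
    · exact (hV.resolve_right h).symm
  change insert (insert k (if V ∈ π.parts then V else ∅))
    (π.parts.erase (if V ∈ π.parts then V else ∅)) = _
  rw [this]

/-- Adding the position `k` does not change the restriction to `I`, hence not the nested expectations
over gaps inside `I` either. -/
theorem restrict_adjoin {π : Finpartition I} (hk : ∀ x ∈ I, x < k) {V : Finset (Fin n)}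
    (hV : V = ∅ ∨ V ∈ π.parts) :
    (adjoin π hk V).restrict (Finset.subset_insert k I) = π := by
  have hkI : k ∉ I := fun h => lt_irrefl _ (hk k h)
  have hsub : V ⊆ I := by
    rcases hV with rfl | h
    · exact Finset.empty_subset _
    · exact π.subset h
  have hVk : insert k V ∩ I = V := by
    rw [Finset.insert_inter_of_notMem hkI, Finset.inter_eq_left.2 hsub]
  ext U
  rw [mem_parts_restrict, parts_adjoin hk hV]
  constructor
  · rintro ⟨hU, W, hW, rfl⟩
    rcases Finset.mem_insert.1 hW with rfl | hW
    · rw [hVk] at hU ⊢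
      exact hV.resolve_left hU.ne_empty
    · have hW := Finset.mem_of_mem_erase hW
      rwa [Finset.inter_eq_left.2 (π.subset hW)]
  · intro hU
    refine ⟨π.nonempty_of_mem_parts hU, ?_⟩
    rcases eq_or_ne U V with rfl | hUV
    · exact ⟨_, Finset.mem_insert_self _ _, hVk⟩
    · exact ⟨U, Finset.mem_insert_of_mem (Finset.mem_erase.2 ⟨hUV, hU⟩),
        Finset.inter_eq_left.2 (π.subset hU)⟩

/-- The block of the last position `k` of `π`, without `k`. -/
def lastRest (π : Finpartition (insert k I)) : Finset (Fin n) :=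
  (π.part k).erase k

theorem insert_lastRest (π : Finpartition (insert k I)) : insert k (lastRest π) = π.part k :=
  Finset.insert_erase (π.mem_part_self.2 (Finset.mem_insert_self _ _))

theorem lastRest_subset (π : Finpartition (insert k I)) : lastRest π ⊆ I := by
  intro x hx
  obtain ⟨hxk, hx⟩ := Finset.mem_erase.1 hx
  exact (Finset.mem_insert.1 (π.part_subset _ hx)).resolve_left hxk

theorem part_mem_parts (π : Finpartition (insert k I)) : π.part k ∈ π.parts :=
  π.part_mem.2 (Finset.mem_insert_self _ _)

theorem subset_of_ne_part (π : Finpartition (insert k I)) {U : Finset (Fin n)}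
    (hU : U ∈ π.parts) (hne : U ≠ π.part k) : U ⊆ I := by
  intro x hx
  refine (Finset.mem_insert.1 (π.subset hU hx)).resolve_left ?_
  rintro rfl
  exact hne (π.part_eq_of_mem hU hx).symm

theorem mem_parts_restrict_insert (π : Finpartition (insert k I)) (hkI : k ∉ I)
    {U : Finset (Fin n)} :
    U ∈ (π.restrict (Finset.subset_insert k I)).parts ↔
      (U ∈ π.parts ∧ U ≠ π.part k) ∨ (U.Nonempty ∧ U = lastRest π) := by
  have hk : π.part k ∩ I = lastRest π := by
    rw [← insert_lastRest, Finset.insert_inter_of_notMem hkI,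
      Finset.inter_eq_left.2 (lastRest_subset π)]
  rw [mem_parts_restrict]
  constructor
  · rintro ⟨hU, W, hW, rfl⟩
    rcases eq_or_ne W (π.part k) with rfl | hne
    · exact Or.inr ⟨hU, hk⟩
    · rw [Finset.inter_eq_left.2 (subset_of_ne_part π hW hne)]
      exact Or.inl ⟨hW, hne⟩
  · rintro (⟨hU, hne⟩ | ⟨hU, rfl⟩)
    · exact ⟨π.nonempty_of_mem_parts hU, U, hU,
        Finset.inter_eq_left.2 (subset_of_ne_part π hU hne)⟩
    · exact ⟨hU, _, part_mem_parts π, hk⟩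

theorem lastRest_eq_empty_or_mem (π : Finpartition (insert k I)) (hkI : k ∉ I) :
    lastRest π = ∅ ∨ lastRest π ∈ (π.restrict (Finset.subset_insert k I)).parts := by
  rcases (lastRest π).eq_empty_or_nonempty with h | h
  · exact Or.inl h
  · exact Or.inr ((mem_parts_restrict_insert π hkI).2 (Or.inr ⟨h, rfl⟩))

theorem lastRest_notMem (π : Finpartition (insert k I)) : lastRest π ∉ π.parts := by
  intro h
  obtain ⟨x, hx⟩ := π.nonempty_of_mem_parts h
  have := π.eq_of_mem_parts h (part_mem_parts π) hx (Finset.mem_of_mem_erase hx)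
  have hk : k ∈ lastRest π := this ▸ π.mem_part_self.2 (Finset.mem_insert_self _ _)
  exact Finset.ne_of_mem_erase hk rfl

theorem adjoin_restrict (π : Finpartition (insert k I)) (hk : ∀ x ∈ I, x < k) :
    adjoin (π.restrict (Finset.subset_insert k I)) hk (lastRest π) = π := by
  have hkI : k ∉ I := fun h => lt_irrefl _ (hk k h)
  ext U
  rw [parts_adjoin hk (lastRest_eq_empty_or_mem π hkI), Finset.mem_insert, Finset.mem_erase,
    mem_parts_restrict_insert π hkI, insert_lastRest]
  constructor
  · rintro (rfl | ⟨h, ⟨hU, -⟩ | ⟨-, hU⟩⟩)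
    · exact part_mem_parts π
    · exact hU
    · exact absurd hU h
  · intro hU
    by_cases h : U = π.part k
    · exact Or.inl h
    · refine Or.inr ⟨?_, Or.inl ⟨hU, h⟩⟩
      rintro rfl
      exact lastRest_notMem π hU

theorem lastRest_adjoin {π : Finpartition I} (hk : ∀ x ∈ I, x < k) {V : Finset (Fin n)}
    (hV : V = ∅ ∨ V ∈ π.parts) :
    (adjoin π hk V).part k = insert k V ∧ lastRest (adjoin π hk V) = V := by
  have hkV : k ∉ V := by
    rcases hV with rfl | h
    · simp
    · exact fun hkV => lt_irrefl _ (hk k (π.subset h hkV))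
  have h : (adjoin π hk V).part k = insert k V := by
    refine Finpartition.part_eq_of_mem _ ?_ (Finset.mem_insert_self _ _)
    rw [parts_adjoin hk hV]
    exact Finset.mem_insert_self _ _
  exact ⟨h, by rw [lastRest, h, Finset.erase_insert hkV]⟩

end Extension

/-! ### Incomplete non-crossing partitions with one more position -/

section Decomposition

variable {n : ℕ} {I : Finset (Fin n)} {k : Fin n}

/-- The position `k` joins the block `V` (or forms a new block if `V = ∅`), and the resulting block
is open. -/
def extOpen (hk : ∀ x ∈ I, x < k) (p : Finpartition I × Finset (Finset (Fin n)))
    (V : Finset (Fin n)) : Finpartition (insert k I) × Finset (Finset (Fin n)) :=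
  (adjoin p.1 hk V, insert (insert k V) (p.2.erase V))

/-- The position `k` joins the block `V` (or forms a new block if `V = ∅`), and the resulting block
is closed. -/
def extClosed (hk : ∀ x ∈ I, x < k) (p : Finpartition I × Finset (Finset (Fin n)))
    (V : Finset (Fin n)) : Finpartition (insert k I) × Finset (Finset (Fin n)) :=
  (adjoin p.1 hk V, p.2.erase V)

theorem eq_empty_or_mem_of_mem_pair {p : Finpartition I × Finset (Finset (Fin n))}
    (hp : p ∈ INCOn I) {V : Finset (Fin n)} (hV : V ∈ ({∅, topBlock p.2} : Finset _)) :
    V = ∅ ∨ (V ∈ p.2 ∧ ∀ U ∈ p.2, U.max ≤ V.max) := by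
  rw [Finset.mem_insert, Finset.mem_singleton] at hV
  rcases hV with rfl | rfl
  · exact Or.inl rfl
  · rcases p.2.eq_empty_or_nonempty with h | h
    · left; rw [h, topBlock_empty]
    · exact Or.inr (topBlock_spec hp h)

theorem extOpen_mem_of_max_le (hk : ∀ x ∈ I, x < k) {p : Finpartition I × Finset (Finset (Fin n))}
    (hp : p ∈ INCOn I) {V : Finset (Fin n)}
    (hV : V = ∅ ∨ (V ∈ p.2 ∧ ∀ U ∈ p.2, U.max ≤ V.max)) :
    extOpen hk p V ∈ INCOn (insert k I) := by
  have hnc := (mem_INCOn.1 hp).1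
  have hS := (mem_INCOn.1 hp).2
  have hVπ : V = ∅ ∨ V ∈ p.1.parts := hV.imp_right fun h => mem_parts_of_mem_INCOn hp h.1
  have hparts := parts_adjoin hk hVπ
  -- an old block covers neither `k` nor an element of `V`
  have hVout : ∀ W ∈ p.1.parts, W ≠ V → ∀ x ∈ insert k V, ∀ i ∈ W, ∀ j ∈ W, ¬ (i < x ∧ x < j) := by
    intro W hW hWV x hx i hi j hj hij
    rcases Finset.mem_insert.1 hx with rfl | hx
    · exact lt_asymm hij.2 (hk j (p.1.subset hW hj))
    · rcases hV with rfl | h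
      · simp at hx
      · exact (mem_outerBlocks.1 (hS h.1)).2 W hW hWV x hx i hi j hj hij
  -- the new block does not cover an element of another open block
  have hVcov : ∀ U ∈ p.2, U ≠ V → ∀ x ∈ U, ∀ i ∈ V, ¬ i < x := by
    intro U hU hUV x hx i hi
    rcases hV with rfl | h
    · simp at hi
    · exact lt_asymm (forall_lt_of_max_le (hS hU) (hS h.1) hUV (h.2 U hU) x hx i hi)
  have hkU : ∀ U ∈ p.1.parts, ∀ x ∈ U, x < k := fun U hU x hx => hk x (p.1.subset hU hx)
  rw [mem_INCOn]
  refine ⟨?_, ?_⟩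
  · intro U hU W hW hUW i hi k' hk' j hj l hl h
    change U ∈ (adjoin p.1 hk V).parts at hU
    change W ∈ (adjoin p.1 hk V).parts at hW
    rw [hparts, Finset.mem_insert, Finset.mem_erase] at hU hW
    rcases hU with rfl | ⟨hUV, hU⟩ <;> rcases hW with rfl | ⟨hWV, hW⟩
    · exact hUW rfl
    · exact hVout W hW hWV k' hk' j hj l hl h.2
    · exact hVout U hU hUV j hj i hi k' hk' ⟨h.1, h.2.1⟩
    · exact hnc U hU W hW hUW i hi k' hk' j hj l hl h
  · intro U hU
    change U ∈ insert (insert k V) (p.2.erase V) at hU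
    rw [mem_outerBlocks]
    change U ∈ (adjoin p.1 hk V).parts ∧ ∀ W ∈ (adjoin p.1 hk V).parts, _
    rw [hparts]
    rw [Finset.mem_insert, Finset.mem_erase] at hU
    rcases hU with rfl | ⟨hUV, hU⟩
    · refine ⟨Finset.mem_insert_self _ _, fun W hW hWV => ?_⟩
      have hW := (Finset.mem_insert.1 hW).resolve_left hWV
      exact hVout W (Finset.mem_of_mem_erase hW) (Finset.ne_of_mem_erase hW)
    · have hUπ := mem_parts_of_mem_INCOn hp hU
      refine ⟨Finset.mem_insert_of_mem (Finset.mem_erase.2 ⟨hUV, hUπ⟩), fun W hW hWU => ?_⟩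
      rcases Finset.mem_insert.1 hW with rfl | hW
      · intro x hx i hi j hj hij
        rcases Finset.mem_insert.1 hi with rfl | hi
        · exact lt_asymm hij.1 (hkU U hUπ x hx)
        · exact hVcov U hU hUV x hx i hi hij.1
      · exact (mem_outerBlocks.1 (hS hU)).2 W (Finset.mem_of_mem_erase hW) hWU

theorem extOpen_mem (hk : ∀ x ∈ I, x < k) {p : Finpartition I × Finset (Finset (Fin n))}
    (hp : p ∈ INCOn I) {V : Finset (Fin n)} (hV : V ∈ ({∅, topBlock p.2} : Finset _)) :
    extOpen hk p V ∈ INCOn (insert k I) :=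
  extOpen_mem_of_max_le hk hp (eq_empty_or_mem_of_mem_pair hp hV)

theorem extClosed_mem (hk : ∀ x ∈ I, x < k) {p : Finpartition I × Finset (Finset (Fin n))}
    (hp : p ∈ INCOn I) {V : Finset (Fin n)} (hV : V ∈ ({∅, topBlock p.2} : Finset _)) :
    extClosed hk p V ∈ INCOn (insert k I) := by
  have h := mem_INCOn.1 (extOpen_mem hk hp hV)
  exact mem_INCOn.2 ⟨h.1, (Finset.subset_insert _ _).trans h.2⟩

/-- The incomplete partition of `I` from which `p` arises by adding the position `k`. A block that
contains `k` together with other positions comes from an open block, whether it is open or not. -/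
def removeLast (p : Finpartition (insert k I) × Finset (Finset (Fin n))) :
    Finpartition I × Finset (Finset (Fin n)) :=
  (p.1.restrict (Finset.subset_insert k I),
    if lastRest p.1 = ∅ then p.2.erase (p.1.part k)
    else insert (lastRest p.1) (p.2.erase (p.1.part k)))

/-- Without `k`, the block of `k` is an outer block, and it is the last open one: an outer block that
ends between it and `k` would be covered by the block of `k`. -/
theorem removeLast_mem (hk : ∀ x ∈ I, x < k)
    {p : Finpartition (insert k I) × Finset (Finset (Fin n))} (hp : p ∈ INCOn (insert k I)) :
    removeLast p ∈ INCOn I ∧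
      lastRest p.1 ∈ ({∅, topBlock (removeLast p).2} : Finset _) := by
  have hkI : k ∉ I := fun h => lt_irrefl _ (hk k h)
  have hnc := (mem_INCOn.1 hp).1
  have hS := (mem_INCOn.1 hp).2
  have hpart := part_mem_parts p.1
  have hkp : k ∈ p.1.part k := p.1.mem_part_self.2 (Finset.mem_insert_self _ _)
  have hrest : lastRest p.1 ⊆ p.1.part k := Finset.erase_subset _ _
  have hmem := fun U => mem_parts_restrict_insert p.1 hkI (U := U)
  have hold : ∀ U ∈ p.2.erase (p.1.part k), U ∈ p.1.parts ∧ U ⊆ I ∧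
      U ∈ outerBlocks (p.1.restrict (Finset.subset_insert k I)) := by
    intro U hU
    obtain ⟨hne, hU⟩ := Finset.mem_erase.1 hU
    obtain ⟨hUπ, hout⟩ := mem_outerBlocks.1 (hS hU)
    refine ⟨hUπ, subset_of_ne_part p.1 hUπ hne, mem_outerBlocks.2
      ⟨(hmem U).2 (Or.inl ⟨hUπ, hne⟩), fun W hW hWU x hx i hi j hj => ?_⟩⟩
    rcases (hmem W).1 hW with ⟨hW, -⟩ | ⟨-, rfl⟩
    · exact hout W hW hWU x hx i hi j hj
    · exact hout _ hpart hne.symm x hx i (hrest hi) j (hrest hj)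
  have hmax : ∀ U ∈ p.2.erase (p.1.part k), lastRest p.1 ≠ ∅ → U.max ≤ (lastRest p.1).max := by
    intro U hU hne
    obtain ⟨m, hm⟩ := Finset.max_of_nonempty (Finset.nonempty_iff_ne_empty.2 hne)
    rw [hm]
    refine Finset.max_le fun u hu => WithBot.coe_le_coe.2 ?_
    by_contra hlt
    exact (mem_outerBlocks.1 (hS (Finset.mem_of_mem_erase hU))).2 _ hpart
      (Finset.ne_of_mem_erase hU).symm u hu m (hrest (Finset.mem_of_max hm)) k hkp
      ⟨not_le.1 hlt, hk u ((hold U hU).2.1 hu)⟩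
  have hmemINC : removeLast p ∈ INCOn I := by
    refine mem_INCOn.2 ⟨hnc.restrict (Finset.subset_insert k I), ?_⟩
    intro U hU
    rw [removeLast] at hU
    change U ∈ outerBlocks (p.1.restrict (Finset.subset_insert k I))
    dsimp only at hU
    split_ifs at hU with h
    · exact (hold U hU).2.2
    rcases Finset.mem_insert.1 hU with rfl | hU
    · refine mem_outerBlocks.2 ⟨(hmem _).2 (Or.inr ⟨Finset.nonempty_iff_ne_empty.2 h, rfl⟩), ?_⟩
      intro W hW hWV x hx i hi j hj hij
      rcases (hmem W).1 hW with ⟨hW, hne⟩ | ⟨-, rfl⟩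
      · exact hnc W hW _ hpart hne i hi j hj x (hrest hx) k hkp
          ⟨hij.1, hij.2, hk j (subset_of_ne_part p.1 hW hne hj)⟩
      · exact hWV rfl
    · exact (hold U hU).2.2
  refine ⟨hmemINC, ?_⟩
  rw [Finset.mem_insert, Finset.mem_singleton]
  by_cases h : lastRest p.1 = ∅
  · exact Or.inl h
  · right
    have hSr : (removeLast p).2 = insert (lastRest p.1) (p.2.erase (p.1.part k)) := if_neg h
    refine (topBlock_eq hmemINC ?_ ?_).symm
    · rw [hSr]; exact Finset.mem_insert_self _ _
    · intro U hU
      rw [hSr] at hU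
      rcases Finset.mem_insert.1 hU with rfl | hU
      · exact le_rfl
      · exact hmax U hU h

theorem removeLast_erase {p : Finpartition (insert k I) × Finset (Finset (Fin n))}
    (hp : p ∈ INCOn (insert k I)) :
    (removeLast p).2.erase (lastRest p.1) = p.2.erase (p.1.part k) := by
  have h : lastRest p.1 ∉ p.2.erase (p.1.part k) := fun h =>
    lastRest_notMem p.1 (mem_parts_of_mem_INCOn hp (Finset.mem_of_mem_erase h))
  rw [removeLast]
  dsimp only
  split_ifs
  · exact Finset.erase_eq_of_notMem h
  · exact Finset.erase_insert h

theorem ext_removeLast (hk : ∀ x ∈ I, x < k)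
    {p : Finpartition (insert k I) × Finset (Finset (Fin n))} (hp : p ∈ INCOn (insert k I)) :
    (if p.1.part k ∈ p.2 then extOpen hk (removeLast p) (lastRest p.1)
      else extClosed hk (removeLast p) (lastRest p.1)) = p := by
  have h := adjoin_restrict p.1 hk
  split_ifs with hS
  · refine Prod.ext h ?_
    change insert (insert k (lastRest p.1)) ((removeLast p).2.erase (lastRest p.1)) = p.2
    rw [removeLast_erase hp, insert_lastRest, Finset.insert_erase hS]
  · refine Prod.ext h ?_
    change (removeLast p).2.erase (lastRest p.1) = p.2
    rw [removeLast_erase hp, Finset.erase_eq_of_notMem hS]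

theorem removeLast_adjoin (hk : ∀ x ∈ I, x < k) {p : Finpartition I × Finset (Finset (Fin n))}
    (hp : p ∈ INCOn I) {V : Finset (Fin n)} (hV : V = ∅ ∨ V ∈ p.2)
    {S : Finset (Finset (Fin n))} (hS : S.erase (insert k V) = p.2.erase V) :
    removeLast (adjoin p.1 hk V, S) = p := by
  have hV' := hV.imp_right fun h => mem_parts_of_mem_INCOn hp h
  obtain ⟨h₁, h₂⟩ := lastRest_adjoin hk hV'
  refine Prod.ext (restrict_adjoin hk hV') ?_
  rw [removeLast]
  dsimp only
  rw [h₁, h₂, hS]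
  split_ifs with h
  · refine Finset.erase_eq_of_notMem fun hVS => ?_
    exact p.1.ne_empty (mem_parts_of_mem_INCOn hp hVS) h
  · exact Finset.insert_erase (hV.resolve_left h)

/-- Every incomplete non-crossing partition of `insert k I`, with `k` the last position, arises in
exactly one way from one of `I`: the position `k` forms a new block or joins the last open block,
and the block of `k` is then open or closed. -/
theorem sum_INCOn_insert {G : Type*} [AddCommMonoid G] (hk : ∀ x ∈ I, x < k)
    (f : Finpartition (insert k I) × Finset (Finset (Fin n)) → G) :
    ∑ p ∈ INCOn (insert k I), f p =
      ∑ p ∈ INCOn I, ∑ V ∈ ({∅, topBlock p.2} : Finset (Finset (Fin n))),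
        (f (extOpen hk p V) + f (extClosed hk p V)) := by
  have hkI : k ∉ I := fun h => lt_irrefl _ (hk k h)
  have hbool : ∀ (p : Finpartition I × Finset (Finset (Fin n))) (V : Finset (Fin n)),
      f (extOpen hk p V) + f (extClosed hk p V) =
        ∑ b : Bool, f (if b then extOpen hk p V else extClosed hk p V) := by
    intro p V
    simp
  simp only [hbool, ← Finset.sum_product']
  rw [Finset.sum_sigma']
  refine Finset.sum_bij' (fun p _ => ⟨removeLast p, lastRest p.1, decide (p.1.part k ∈ p.2)⟩)
    (fun q _ => if q.2.2 then extOpen hk q.1 q.2.1 else extClosed hk q.1 q.2.1) ?_ ?_ ?_ ?_ ?_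
  · intro p hp
    obtain ⟨h₁, h₂⟩ := removeLast_mem hk hp
    simp only [Finset.mem_sigma, Finset.mem_product, Finset.mem_univ, and_true]
    exact ⟨h₁, h₂⟩
  · rintro ⟨p, V, b⟩ hq
    simp only [Finset.mem_sigma, Finset.mem_product, Finset.mem_univ, and_true] at hq
    cases b
    · exact extClosed_mem hk hq.1 hq.2
    · exact extOpen_mem hk hq.1 hq.2
  · intro p hp
    simp only [decide_eq_true_eq]
    exact ext_removeLast hk hp
  · rintro ⟨p, V, b⟩ hq
    simp only [Finset.mem_sigma, Finset.mem_product, Finset.mem_univ, and_true] at hq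
    obtain ⟨hp, hV⟩ := hq
    have hV := (eq_empty_or_mem_of_mem_pair hp hV).imp_right And.left
    obtain ⟨h₁, h₂⟩ := lastRest_adjoin hk (hV.imp_right fun h => mem_parts_of_mem_INCOn hp h)
    have hnot : insert k V ∉ p.2.erase V := fun h => hkI
      (p.1.subset (mem_parts_of_mem_INCOn hp (Finset.mem_of_mem_erase h))
        (Finset.mem_insert_self k V))
    cases b
    · have h₃ := removeLast_adjoin hk hp hV (S := p.2.erase V) (Finset.erase_eq_of_notMem hnot)
      simp [extClosed, h₁, h₂, h₃, hnot]
    · have h₃ := removeLast_adjoin hk hp hV (S := insert (insert k V) (p.2.erase V))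
        (Finset.erase_insert hnot)
      simp [extOpen, h₁, h₂, h₃]
  · intro p hp
    simp only [decide_eq_true_eq]
    rw [ext_removeLast hk hp]

end Decomposition

/-! ### Contractions with one more position -/

section Contraction

variable {D M : Type*} [Ring D] [NonUnitalRing M] [Module Dᵐᵒᵖ M]
variable {n : ℕ} {I : Finset (Fin n)} {k : Fin n}

/-- The nested expectation of the positions before all open blocks. -/
noncomputable def prefactor (E : M → D) (a : Fin n → M)
    (p : Finpartition I × Finset (Finset (Fin n))) : D :=
  nestedExp E a (gapBefore I (p.2.biUnion id)) (p.1.restrict (Finset.filter_subset _ _))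

/-- The tensor factor that the open block `V` of `p` contributes to a contraction. -/
noncomputable def openFactor (E : M → D) (a : Fin n → M)
    (p : Finpartition I × Finset (Finset (Fin n))) (V : Finset (Fin n)) : M :=
  nonunitalProd ((V.sort (· ≤ ·)).map fun v =>
    MulOpposite.op (nestedExp E a (gapAfter I (p.2.biUnion id) v)
      (p.1.restrict (Finset.filter_subset _ _))) • a v)

/-- The contraction of `a` along an incomplete non-crossing partition of a set `I` of positions. -/
noncomputable def contractionOn [Algebra ℂ D] [Module D M] (E : M → D) (F : List M → Gamma D M) (a : Fin n → M)
    (p : Finpartition I × Finset (Finset (Fin n))) : Gamma D M :=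
  Gamma.coeff M (prefactor E a p) * F ((sortByMax p.2).map (openFactor E a p))

/-- The factor of the block that arises when `k` joins the open block `V` of `p`, or forms a new
block if `V = ∅`. -/
noncomputable def joinFactor (E : M → D) (a : Fin n → M) (k : Fin n)
    (p : Finpartition I × Finset (Finset (Fin n))) (V : Finset (Fin n)) : M :=
  if V = ∅ then a k else openFactor E a p V * a k

theorem contraction_eq_contractionOn [Algebra ℂ D] [Module D M] (E : M → D) (F : List M → Gamma D M) (a : Fin n → M)
    (p : Finpartition (Finset.univ : Finset (Fin n)) × Finset (Finset (Fin n))) :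
    contraction E F a p = contractionOn E F a p := rfl

theorem mem_gapAfter {A : Finset (Fin n)} {v x : Fin n} :
    x ∈ gapAfter I A v ↔ x ∈ I ∧ v < x ∧ ∀ w ∈ A, v < w → x < w := by
  simp [gapAfter]

theorem mem_gapInside {V : Finset (Fin n)} {v x : Fin n} :
    x ∈ gapInside I V v ↔ x ∈ I ∧ v < x ∧ (∃ w ∈ V, x < w) ∧ ∀ w ∈ V, v < w → x < w := by
  simp [gapInside]

theorem mem_gapBefore {A : Finset (Fin n)} {x : Fin n} :
    x ∈ gapBefore I A ↔ x ∈ I ∧ ∀ w ∈ A, x < w := by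
  simp [gapBefore]

theorem mem_openPositions {S : Finset (Finset (Fin n))} {x : Fin n} :
    x ∈ S.biUnion id ↔ ∃ U ∈ S, x ∈ U := by
  simp

/-- An open block that is the last one, or no block. -/
abbrev IsLastOpen (p : Finpartition I × Finset (Finset (Fin n))) (V : Finset (Fin n)) : Prop :=
  V = ∅ ∨ (V ∈ p.2 ∧ ∀ U ∈ p.2, U.max ≤ V.max)

variable {p : Finpartition I × Finset (Finset (Fin n))} {V : Finset (Fin n)}

theorem IsLastOpen.mem_parts (hp : p ∈ INCOn I) (hV : IsLastOpen p V) :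
    V = ∅ ∨ V ∈ p.1.parts :=
  hV.imp_right fun h => mem_parts_of_mem_INCOn hp h.1

theorem IsLastOpen.subset (hp : p ∈ INCOn I) (hV : IsLastOpen p V) : V ⊆ I := by
  rcases hV.mem_parts hp with rfl | h
  · exact Finset.empty_subset _
  · exact p.1.subset h

theorem IsLastOpen.lt (hp : p ∈ INCOn I) (hV : IsLastOpen p V) {U : Finset (Fin n)}
    (hU : U ∈ p.2) (hUV : U ≠ V) : ∀ x ∈ U, ∀ y ∈ V, x < y := by
  rcases hV with rfl | h
  · simp
  · exact forall_lt_of_max_le ((mem_INCOn.1 hp).2 hU) ((mem_INCOn.1 hp).2 h.1) hUV (h.2 U hU)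

theorem subset_of_mem_INCOn (hp : p ∈ INCOn I) {U : Finset (Fin n)} (hU : U ∈ p.2) : U ⊆ I :=
  p.1.subset (mem_parts_of_mem_INCOn hp hU)

theorem openPositions_extOpen (hk : ∀ x ∈ I, x < k) (hV : IsLastOpen p V) {x : Fin n} :
    x ∈ (extOpen hk p V).2.biUnion id ↔ x = k ∨ x ∈ p.2.biUnion id := by
  simp only [mem_openPositions, extOpen, Finset.mem_insert, Finset.mem_erase]
  constructor
  · rintro ⟨U, rfl | ⟨-, hU⟩, hx⟩
    · rcases Finset.mem_insert.1 hx with rfl | hx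
      · exact Or.inl rfl
      · rcases hV with rfl | h
        · simp at hx
        · exact Or.inr ⟨V, h.1, hx⟩
    · exact Or.inr ⟨U, hU, hx⟩
  · rintro (rfl | ⟨U, hU, hx⟩)
    · exact ⟨_, Or.inl rfl, Finset.mem_insert_self _ _⟩
    · by_cases h : U = V
      · exact ⟨_, Or.inl rfl, Finset.mem_insert_of_mem (h ▸ hx)⟩
      · exact ⟨U, Or.inr ⟨h, hU⟩, hx⟩

/-- An open `k` bounds the last gap just where the end of `I` did before, so no nested expectation
changes. -/
theorem prefactor_extOpen (E : M → D) (a : Fin n → M) (hk : ∀ x ∈ I, x < k) (hp : p ∈ INCOn I)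
    (hV : IsLastOpen p V) : prefactor E a (extOpen hk p V) = prefactor E a p := by
  refine nestedExp_restrict_congr E a (restrict_adjoin hk (hV.mem_parts hp)) ?_ _ _
  ext x
  simp only [mem_gapBefore, openPositions_extOpen hk hV, Finset.mem_insert]
  constructor
  · rintro ⟨rfl | hx, h⟩
    · exact absurd (h x (Or.inl rfl)) (lt_irrefl x)
    · exact ⟨hx, fun w hw => h w (Or.inr hw)⟩
  · rintro ⟨hx, h⟩
    refine ⟨Or.inr hx, ?_⟩
    rintro w (rfl | hw)
    exacts [hk x hx, h w hw]

theorem gapAfter_extOpen (hk : ∀ x ∈ I, x < k) (hV : IsLastOpen p V) {v : Fin n} (hv : v < k) :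
    gapAfter (insert k I) ((extOpen hk p V).2.biUnion id) v =
      gapAfter I (p.2.biUnion id) v := by
  ext x
  simp only [mem_gapAfter, openPositions_extOpen hk hV, Finset.mem_insert]
  constructor
  · rintro ⟨rfl | hx, hvx, h⟩
    · exact absurd (h x (Or.inl rfl) hv) (lt_irrefl x)
    · exact ⟨hx, hvx, fun w hw => h w (Or.inr hw)⟩
  · rintro ⟨hx, hvx, h⟩
    refine ⟨Or.inr hx, hvx, ?_⟩
    rintro w (rfl | hw)
    exacts [fun _ => hk x hx, h w hw]

theorem openFactor_extOpen (E : M → D) (a : Fin n → M) (hk : ∀ x ∈ I, x < k) (hp : p ∈ INCOn I)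
    (hV : IsLastOpen p V) {U : Finset (Fin n)} (hU : U ⊆ I) :
    openFactor E a (extOpen hk p V) U = openFactor E a p U := by
  refine congrArg nonunitalProd (List.map_congr_left fun v hv => ?_)
  refine congrArg (fun d => MulOpposite.op d • a v) (nestedExp_restrict_congr E a
    (restrict_adjoin hk (hV.mem_parts hp)) (gapAfter_extOpen hk hV (hk v (hU ?_))) _ _)
  simpa using hv

theorem openFactor_extOpen_insert (E : M → D) (a : Fin n → M) (hk : ∀ x ∈ I, x < k)
    (hp : p ∈ INCOn I) (hV : IsLastOpen p V) :
    openFactor E a (extOpen hk p V) (insert k V) = joinFactor E a k p V := by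
  have hVI := hV.subset hp
  have hlast : nestedExp E a (gapAfter (insert k I) ((extOpen hk p V).2.biUnion id) k)
      ((extOpen hk p V).1.restrict (Finset.filter_subset _ _)) = 1 := by
    refine nestedExp_empty E a ?_ _
    rw [Finset.eq_empty_iff_forall_notMem]
    intro x hx
    obtain ⟨hx, hkx, -⟩ := mem_gapAfter.1 hx
    rcases Finset.mem_insert.1 hx with rfl | hx
    · exact lt_irrefl _ hkx
    · exact lt_asymm hkx (hk x hx)
  have h := openFactor_extOpen E a hk hp hV hVI
  rw [openFactor] at h
  rw [openFactor, sort_insert_of_forall_lt (fun x hx => hk x (hVI hx)), List.map_append,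
    List.map_singleton, hlast, MulOpposite.op_one, one_smul, joinFactor]
  split_ifs with hV0
  · subst hV0; simp [nonunitalProd]
  · rw [nonunitalProd_append_singleton, h]
    intro h0
    refine hV0 (Finset.card_eq_zero.1 ?_)
    simpa using congrArg List.length h0

/-- Opening the block of `k` makes the factor of that block the last argument of `F`. -/
theorem contractionOn_extOpen [Algebra ℂ D] [Module D M] (E : M → D) (F : List M → Gamma D M) (a : Fin n → M)
    (hk : ∀ x ∈ I, x < k) (hp : p ∈ INCOn I) (hV : IsLastOpen p V) :
    contractionOn E F a (extOpen hk p V) = Gamma.coeff M (prefactor E a p) *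
      F ((sortByMax (p.2.erase V)).map (openFactor E a p) ++ [joinFactor E a k p V]) := by
  have hsort : sortByMax (extOpen hk p V).2 = sortByMax (p.2.erase V) ++ [insert k V] := by
    refine sortByMax_insert (fun U hU W hW => ?_) fun U hU => ?_
    · exact eq_of_max_eq (mem_parts_of_mem_INCOn hp (Finset.mem_of_mem_erase hU))
        (mem_parts_of_mem_INCOn hp (Finset.mem_of_mem_erase hW))
    · have hUπ := mem_parts_of_mem_INCOn hp (Finset.mem_of_mem_erase hU)
      obtain ⟨m, hm⟩ := Finset.max_of_nonempty (p.1.nonempty_of_mem_parts hUπ)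
      rw [hm]
      exact lt_of_lt_of_le (WithBot.coe_lt_coe.2 (hk m (p.1.subset hUπ (Finset.mem_of_max hm))))
        (Finset.le_max (Finset.mem_insert_self _ _))
  rw [contractionOn, prefactor_extOpen E a hk hp hV, hsort, List.map_append, List.map_singleton,
    openFactor_extOpen_insert E a hk hp hV]
  congr 3
  refine List.map_congr_left fun U hU => openFactor_extOpen E a hk hp hV ?_
  exact subset_of_mem_INCOn hp (Finset.mem_of_mem_erase (mem_sortByMax.1 hU))

/-- When `k` closes the block `V`, the nested expectation over the gap `J'` that ends at `k` is the
one over the part of the gap before `V` times the expectation of the closed block. -/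
theorem nestedExp_gap_extClosed (E : M → D) (a : Fin n → M) (hk : ∀ x ∈ I, x < k)
    (hp : p ∈ INCOn I) (hV : IsLastOpen p V) {J J' : Finset (Fin n)} (hJ : J ⊆ I)
    (hJ' : J' ⊆ insert k I) (hup : ∀ x ∈ insert k I, ∀ v ∈ insert k V, v ≤ x → x ∈ J')
    (hJJ' : gapBefore J' (insert k V) = J) :
    nestedExp E a J' ((adjoin p.1 hk V).restrict hJ') =
      nestedExp E a J (p.1.restrict hJ) * E (joinFactor E a k p V) := by
  have hVp := hV.mem_parts hp
  have hVI := hV.subset hp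
  have hVJ' : insert k V ⊆ J' := fun x hx =>
    hup x (Finset.insert_subset_insert _ hVI hx) x hx le_rfl
  have hmem : insert k V ∈ ((adjoin p.1 hk V).restrict hJ').parts := by
    refine (mem_parts_restrict _ _).2 ⟨Finset.insert_nonempty _ _, insert k V, ?_,
      Finset.inter_eq_left.2 hVJ'⟩
    rw [parts_adjoin hk hVp]
    exact Finset.mem_insert_self _ _
  have hnc : IsNoncrossing (adjoin p.1 hk V) := (mem_INCOn.1 (extOpen_mem_of_max_le hk hp hV)).1
  rw [nestedExp_eq_mul E a (hnc.restrict hJ') hmem (Finset.mem_insert_self k V),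
    ← openFactor_extOpen_insert E a hk hp hV]
  · congr 1
    · refine (nestedExp_restrict_restrict E a _ hJ' _).trans ?_
      exact nestedExp_restrict_congr E a (restrict_adjoin hk hVp) hJJ' _ _
    · refine congrArg (fun l => E (nonunitalProd l)) (List.map_congr_left fun v hv => ?_)
      have hv : v ∈ insert k V := by simpa using hv
      refine congrArg (fun d => MulOpposite.op d • a v) ?_
      refine (nestedExp_restrict_restrict E a _ hJ' _).trans ?_
      refine nestedExp_restrict_congr E a (π' := adjoin p.1 hk V) (hI := le_rfl)
        (restrict_self _ _) ?_ _ _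
      ext x
      simp only [mem_gapAfter, mem_gapInside, openPositions_extOpen hk hV]
      constructor
      · rintro ⟨hx, hvx, ⟨w, hw, hxw⟩, h⟩
        have hxk : x < k := by
          rcases Finset.mem_insert.1 hw with rfl | hw
          · exact hxw
          · exact hxw.trans (hk w (hVI hw))
        refine ⟨hJ' hx, hvx, ?_⟩
        rintro u (rfl | hu) hvu
        · exact hxk
        · obtain ⟨U, hU, hu⟩ := mem_openPositions.1 hu
          by_cases hUV : U = V
          · exact h u (Finset.mem_insert_of_mem (hUV ▸ hu)) hvu
          · rcases Finset.mem_insert.1 hv with rfl | hv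
            · exact absurd hxk (lt_asymm hvx)
            · exact absurd (hV.lt hp hU hUV u hu v hv) (lt_asymm hvu)
      · rintro ⟨hx, hvx, h⟩
        have hxk : x < k := by
          rcases Finset.mem_insert.1 hv with rfl | hv
          · rcases Finset.mem_insert.1 hx with rfl | hx
            · exact absurd hvx (lt_irrefl _)
            · exact hk x hx
          · exact h k (Or.inl rfl) (hk v (hVI hv))
        refine ⟨hup x hx v hv hvx.le, hvx, ⟨k, Finset.mem_insert_self _ _, hxk⟩, ?_⟩
        intro w hw hvw
        rcases Finset.mem_insert.1 hw with rfl | hw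
        · exact hxk
        · refine h w (Or.inr ?_) hvw
          rcases hV with rfl | hV
          · simp at hw
          · exact mem_openPositions.2 ⟨V, hV.1, hw⟩
  · intro x hx
    rcases Finset.mem_insert.1 (hJ' hx) with rfl | hx
    · exact le_rfl
    · exact (hk x hx).le

/-- Closing the block of `k` multiplies the contraction on the right by the expectation of that
block: the expectation is absorbed by the last open block that is left, or by the prefactor. -/
theorem contractionOn_extClosed [Algebra ℂ D] [Module D M] [SMulCommClass Dᵐᵒᵖ M M]
    (E : M → D) {F : List M → Gamma D M} (a : Fin n → M) (hF : F [] = 1)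
    (hF' : ∀ (l : List M) (a : M) (d : D),
      F (l ++ [MulOpposite.op d • a]) = F (l ++ [a]) * Gamma.coeff M d)
    (hk : ∀ x ∈ I, x < k) (hp : p ∈ INCOn I) (hV : IsLastOpen p V) :
    contractionOn E F a (extClosed hk p V) = Gamma.coeff M (prefactor E a p) *
      F ((sortByMax (p.2.erase V)).map (openFactor E a p)) *
        Gamma.coeff M (E (joinFactor E a k p V)) := by
  have hkI : k ∉ I := fun h => lt_irrefl _ (hk k h)
  have hVI := hV.subset hp
  have hres := restrict_adjoin hk (hV.mem_parts hp)
  have hq : (p.1, p.2.erase V) ∈ INCOn I :=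
    mem_INCOn.2 ⟨(mem_INCOn.1 hp).1, (Finset.erase_subset _ _).trans (mem_INCOn.1 hp).2⟩
  have hA : ∀ w, w ∈ p.2.biUnion id ↔ w ∈ (p.2.erase V).biUnion id ∨ w ∈ V := by
    intro w
    simp only [mem_openPositions, Finset.mem_erase]
    constructor
    · rintro ⟨U, hU, hw⟩
      by_cases h : U = V
      · exact Or.inr (h ▸ hw)
      · exact Or.inl ⟨U, ⟨h, hU⟩, hw⟩
    · rintro (⟨U, ⟨-, hU⟩, hw⟩ | hw)
      · exact ⟨U, hU, hw⟩
      · rcases hV with rfl | h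
        · simp at hw
        · exact ⟨V, h.1, hw⟩
  have hBV : ∀ w ∈ (p.2.erase V).biUnion id, w ∈ I ∧ ∀ v ∈ V, w < v := by
    intro w hw
    obtain ⟨U, hU, hw⟩ := mem_openPositions.1 hw
    obtain ⟨hUV, hU⟩ := Finset.mem_erase.1 hU
    exact ⟨subset_of_mem_INCOn hp hU hw, hV.lt hp hU hUV w hw⟩
  -- if no other block is open, the closed block ends up in the prefactor; otherwise in the gap after
  -- the last position `m` of the last open block `U` that is left
  rcases (p.2.erase V).eq_empty_or_nonempty with hS | hS
  · have hpre : prefactor E a (extClosed hk p V) =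
        prefactor E a p * E (joinFactor E a k p V) := by
      refine nestedExp_gap_extClosed E a hk hp hV (J := gapBefore I (p.2.biUnion id))
        (Finset.filter_subset _ _) _ ?_ ?_
      · intro x hx v hv hvx
        rw [mem_gapBefore]
        refine ⟨hx, fun w hw => ?_⟩
        rw [extClosed, hS] at hw
        simp at hw
      · ext x
        simp only [mem_gapBefore, hA, extClosed, hS, Finset.biUnion_empty, Finset.notMem_empty,
          false_imp_iff, implies_true, and_true, false_or]
        constructor
        · rintro ⟨hx, h⟩
          refine ⟨(Finset.mem_insert.1 hx).resolve_left ?_,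
            fun w hw => h w (Finset.mem_insert_of_mem hw)⟩
          rintro rfl
          exact lt_irrefl _ (h x (Finset.mem_insert_self _ _))
        · rintro ⟨hx, h⟩
          refine ⟨Finset.mem_insert_of_mem hx, fun w hw => ?_⟩
          rcases Finset.mem_insert.1 hw with rfl | hw
          exacts [hk x hx, h w hw]
    rw [contractionOn, hpre, extClosed, hS, sortByMax_empty, List.map_nil, List.map_nil, hF,
      Gamma.coeff_mul, mul_one, mul_one]
  · obtain ⟨U, hU, hUmax⟩ := Finset.exists_max_image (p.2.erase V) Finset.max hS
    have hUp := Finset.mem_of_mem_erase hU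
    obtain ⟨m, hm⟩ := Finset.max_of_nonempty
      (p.1.nonempty_of_mem_parts (mem_parts_of_mem_INCOn hp hUp))
    have hmU := Finset.mem_of_max hm
    have hmB : m ∈ (p.2.erase V).biUnion id := mem_openPositions.2 ⟨U, hU, hmU⟩
    have hBm : ∀ w ∈ (p.2.erase V).biUnion id, w ≤ m := by
      intro w hw
      obtain ⟨W, hW, hw⟩ := mem_openPositions.1 hw
      exact WithBot.coe_le_coe.1 ((Finset.le_max hw).trans ((hUmax W hW).trans hm.le))
    have hmk : m < k := hk m (hBV m hmB).1
    have hpre : prefactor E a (extClosed hk p V) = prefactor E a p := by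
      refine nestedExp_restrict_congr E a hres ?_ _ _
      ext x
      simp only [mem_gapBefore, hA, extClosed]
      constructor
      · rintro ⟨hx, h⟩
        refine ⟨(Finset.mem_insert.1 hx).resolve_left ?_, ?_⟩
        · rintro rfl
          exact lt_asymm hmk (h m hmB)
        · rintro w (hw | hw)
          exacts [h w hw, (h m hmB).trans ((hBV m hmB).2 w hw)]
      · rintro ⟨hx, h⟩
        exact ⟨Finset.mem_insert_of_mem hx, fun w hw => h w (Or.inl hw)⟩
    have hgap : ∀ v, v < m → nestedExp E a
        (gapAfter (insert k I) ((extClosed hk p V).2.biUnion id) v)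
        ((extClosed hk p V).1.restrict (Finset.filter_subset _ _)) =
        nestedExp E a (gapAfter I (p.2.biUnion id) v)
          (p.1.restrict (Finset.filter_subset _ _)) := by
      intro v hvm
      refine nestedExp_restrict_congr E a hres ?_ _ _
      ext x
      simp only [mem_gapAfter, hA, extClosed]
      constructor
      · rintro ⟨hx, hvx, h⟩
        refine ⟨(Finset.mem_insert.1 hx).resolve_left ?_, hvx, ?_⟩
        · rintro rfl
          exact lt_asymm hmk (h m hmB hvm)
        · rintro w (hw | hw) hvw
          exacts [h w hw hvw, (h m hmB hvm).trans ((hBV m hmB).2 w hw)]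
      · rintro ⟨hx, hvx, h⟩
        exact ⟨Finset.mem_insert_of_mem hx, hvx, fun w hw => h w (Or.inl hw)⟩
    have hlast : nestedExp E a (gapAfter (insert k I) ((extClosed hk p V).2.biUnion id) m)
        ((extClosed hk p V).1.restrict (Finset.filter_subset _ _)) =
        nestedExp E a (gapAfter I (p.2.biUnion id) m)
          (p.1.restrict (Finset.filter_subset _ _)) * E (joinFactor E a k p V) := by
      refine nestedExp_gap_extClosed E a hk hp hV (J := gapAfter I (p.2.biUnion id) m)
        (Finset.filter_subset _ _) _ ?_ ?_
      · intro x hx v hv hvx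
        rw [mem_gapAfter]
        refine ⟨hx, ?_, fun w hw hmw => absurd (hBm w hw) (not_le.2 hmw)⟩
        rcases Finset.mem_insert.1 hv with rfl | hv
        · exact hmk.trans_le hvx
        · exact ((hBV m hmB).2 v hv).trans_le hvx
      · ext x
        simp only [mem_gapBefore, mem_gapAfter, hA, extClosed]
        constructor
        · rintro ⟨⟨hx, hmx, -⟩, h⟩
          refine ⟨(Finset.mem_insert.1 hx).resolve_left ?_, hmx, ?_⟩
          · rintro rfl
            exact lt_irrefl _ (h x (Finset.mem_insert_self _ _))
          · rintro w (hw | hw) hmw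
            · exact absurd (hBm w hw) (not_le.2 hmw)
            · exact h w (Finset.mem_insert_of_mem hw)
        · rintro ⟨hx, hmx, h⟩
          refine ⟨⟨Finset.mem_insert_of_mem hx, hmx,
            fun w hw hmw => absurd (hBm w hw) (not_le.2 hmw)⟩, fun w hw => ?_⟩
          rcases Finset.mem_insert.1 hw with rfl | hw
          · exact hk x hx
          · exact h w (Or.inr hw) ((hBV m hmB).2 w hw)
    have hUsort : U.sort (· ≤ ·) = (U.erase m).sort (· ≤ ·) ++ [m] := by
      conv_lhs => rw [← Finset.insert_erase hmU]
      refine sort_insert_of_forall_lt fun x hx => ?_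
      exact lt_of_le_of_ne (hBm x (mem_openPositions.2 ⟨U, hU, Finset.mem_of_mem_erase hx⟩))
        (Finset.ne_of_mem_erase hx)
    have hUfac : openFactor E a (extClosed hk p V) U =
        MulOpposite.op (E (joinFactor E a k p V)) • openFactor E a p U := by
      rw [openFactor, openFactor, hUsort, List.map_append, List.map_append, List.map_singleton,
        List.map_singleton, ← nonunitalProd_append_op_smul, hlast, MulOpposite.op_mul, mul_smul]
      refine congrArg (fun l => nonunitalProd (l ++ _)) (List.map_congr_left fun v hv => ?_)
      have hv : v ∈ U.erase m := by simpa using hv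
      rw [hgap v (lt_of_le_of_ne
        (hBm v (mem_openPositions.2 ⟨U, hU, Finset.mem_of_mem_erase hv⟩))
        (Finset.ne_of_mem_erase hv))]
    have hWfac : ∀ W ∈ (p.2.erase V).erase U, openFactor E a (extClosed hk p V) W =
        openFactor E a p W := by
      intro W hW
      obtain ⟨hWU, hW⟩ := Finset.mem_erase.1 hW
      refine congrArg nonunitalProd (List.map_congr_left fun v hv => ?_)
      have hv : v ∈ W := by simpa using hv
      rw [hgap v (forall_lt_of_max_le ((mem_INCOn.1 hq).2 hW) ((mem_INCOn.1 hq).2 hU) hWU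
        (hUmax W hW) v hv m hmU)]
    have hsort := sortByMax_eq_append hq hU hUmax
    change sortByMax (p.2.erase V) = _ at hsort
    have hsort' : sortByMax (extClosed hk p V).2 =
        sortByMax ((p.2.erase V).erase U) ++ [U] := hsort
    rw [contractionOn, hpre, hsort', hsort, List.map_append, List.map_append, List.map_singleton,
      List.map_singleton, hUfac, hF', mul_assoc]
    congr 4
    exact List.map_congr_left fun W hW => hWfac W (mem_sortByMax.1 hW)

/-- If there is an open block, the sum over the blocks that `k` can join has two terms. -/
theorem sum_topBlock {G : Type*} [AddCommMonoid G] (hp : p ∈ INCOn I) (hS : p.2.Nonempty)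
    (f : Finset (Fin n) → G) :
    ∑ V ∈ ({∅, topBlock p.2} : Finset (Finset (Fin n))), f V = f ∅ + f (topBlock p.2) := by
  refine Finset.sum_pair fun h => ?_
  have := mem_parts_of_mem_INCOn hp (topBlock_spec hp hS).1
  rw [← h] at this
  exact p.1.empty_notMem_parts this

theorem isLastOpen_topBlock (hp : p ∈ INCOn I) (hS : p.2.Nonempty) :
    IsLastOpen p (topBlock p.2) :=
  Or.inr (topBlock_spec hp hS)

theorem topBlock_ne_empty (hp : p ∈ INCOn I) (hS : p.2.Nonempty) : topBlock p.2 ≠ ∅ :=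
  p.1.ne_empty (mem_parts_of_mem_INCOn hp (topBlock_spec hp hS).1)

theorem joinFactor_topBlock (E : M → D) (a : Fin n → M) (hp : p ∈ INCOn I) (hS : p.2.Nonempty) :
    joinFactor E a k p (topBlock p.2) = openFactor E a p (topBlock p.2) * a k :=
  if_neg (topBlock_ne_empty hp hS)

theorem sortByMax_eq_append_topBlock (hp : p ∈ INCOn I) (hS : p.2.Nonempty) :
    sortByMax p.2 = sortByMax (p.2.erase (topBlock p.2)) ++ [topBlock p.2] :=
  sortByMax_eq_append hp (topBlock_spec hp hS).1 (topBlock_spec hp hS).2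

end Contraction

/-! ### Monomials as sums of Wick products -/

section Sums

variable {D M : Type*} [Ring D] [Algebra ℂ D] [NonUnitalRing M] [Module D M] [Module Dᵐᵒᵖ M]
variable {n : ℕ} {I : Finset (Fin n)} {k : Fin n}
variable {p : Finpartition I × Finset (Finset (Fin n))} {V : Finset (Fin n)}

theorem erase_empty_of_mem_INCOn (hp : p ∈ INCOn I) : p.2.erase ∅ = p.2 :=
  Finset.erase_eq_of_notMem fun h => p.1.empty_notMem_parts (mem_parts_of_mem_INCOn hp h)

theorem contractionOn_extOpen_empty (E : M → D) (F : List M → Gamma D M) (a : Fin n → M)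
    (hk : ∀ x ∈ I, x < k) (hp : p ∈ INCOn I) :
    contractionOn E F a (extOpen hk p ∅) = Gamma.coeff M (prefactor E a p) *
      F ((sortByMax p.2).map (openFactor E a p) ++ [a k]) := by
  rw [contractionOn_extOpen E F a hk hp (Or.inl rfl), erase_empty_of_mem_INCOn hp, joinFactor,
    if_pos rfl]

theorem contractionOn_extClosed_empty [SMulCommClass Dᵐᵒᵖ M M]
    (E : M → D) {F : List M → Gamma D M} (a : Fin n → M) (hF : F [] = 1)
    (hF' : ∀ (l : List M) (a : M) (d : D),
      F (l ++ [MulOpposite.op d • a]) = F (l ++ [a]) * Gamma.coeff M d)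
    (hk : ∀ x ∈ I, x < k) (hp : p ∈ INCOn I) :
    contractionOn E F a (extClosed hk p ∅) =
      contractionOn E F a p * Gamma.coeff M (E (a k)) := by
  rw [contractionOn_extClosed E a hF hF' hk hp (Or.inl rfl), erase_empty_of_mem_INCOn hp,
    joinFactor, if_pos rfl, contractionOn]

/-- The four ways of adding the position `k` to an incomplete partition correspond to the four terms
in the expansion of `W(b₁ ⊗ ⋯ ⊗ b_ℓ) X(a)`. -/
theorem sum_contractionOn_wick [SMulCommClass Dᵐᵒᵖ M M] (E : M → D)
    (hW : ∀ (l : List M) (a : M) (d : D),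
      wick E (l ++ [MulOpposite.op d • a]) = wick E (l ++ [a]) * Gamma.coeff M d)
    (a : Fin n → M) (hk : ∀ x ∈ I, x < k) (hp : p ∈ INCOn I) :
    ∑ V ∈ ({∅, topBlock p.2} : Finset (Finset (Fin n))),
        (contractionOn E (wick E) a (extOpen hk p V) +
          contractionOn E (wick E) a (extClosed hk p V)) =
      contractionOn E (wick E) a p * Gamma.X D (a k) := by
  rcases p.2.eq_empty_or_nonempty with hS | hS
  · rw [hS, topBlock_empty, Finset.pair_eq_singleton, Finset.sum_singleton,
      contractionOn_extOpen_empty E _ a hk hp,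
      contractionOn_extClosed_empty E a (wick_nil E) hW hk hp, contractionOn, hS, sortByMax_empty,
      List.map_nil, List.nil_append, wick_nil, wick_singleton]
    noncomm_ring
  · rw [sum_topBlock hp hS, contractionOn_extOpen_empty E _ a hk hp,
      contractionOn_extClosed_empty E a (wick_nil E) hW hk hp,
      contractionOn_extOpen E _ a hk hp (isLastOpen_topBlock hp hS),
      contractionOn_extClosed E a (wick_nil E) hW hk hp (isLastOpen_topBlock hp hS),
      contractionOn, joinFactor_topBlock E a hp hS, sortByMax_eq_append_topBlock hp hS,
      List.map_append, List.map_singleton, List.append_assoc, List.singleton_append, wick_append]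
    noncomm_ring

/-- The first `m` positions. -/
def positionsBelow (n m : ℕ) : Finset (Fin n) :=
  Finset.univ.filter fun x => x.val < m

theorem mem_positionsBelow {m : ℕ} {x : Fin n} : x ∈ positionsBelow n m ↔ x.val < m := by
  simp [positionsBelow]

theorem positionsBelow_zero : positionsBelow n 0 = ∅ := by
  ext x; simp [mem_positionsBelow]

theorem positionsBelow_self : positionsBelow n n = Finset.univ := by
  ext x; simp [mem_positionsBelow]

theorem positionsBelow_succ {m : ℕ} (hm : m < n) :
    positionsBelow n (m + 1) = insert ⟨m, hm⟩ (positionsBelow n m) := by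
  ext x
  rw [Finset.mem_insert, mem_positionsBelow, mem_positionsBelow, Fin.ext_iff]
  change x.val < m + 1 ↔ x.val = m ∨ x.val < m
  omega

theorem lt_of_mem_positionsBelow {m : ℕ} (hm : m < n) :
    ∀ x ∈ positionsBelow n m, x < (⟨m, hm⟩ : Fin n) := fun _ hx =>
  Fin.lt_def.2 (mem_positionsBelow.1 hx)

/-- On the empty set of positions there is one incomplete partition, without any block. -/
theorem sum_INCOn_of_eq_empty {G : Type*} [AddCommMonoid G] (hI : I = ∅)
    (f : Finpartition I × Finset (Finset (Fin n)) → G) : ∑ p ∈ INCOn I, f p = f (⊥, ∅) := by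
  subst hI
  have hparts : ∀ π : Finpartition (∅ : Finset (Fin n)), π.parts = ∅ := fun π =>
    π.parts_eq_empty_iff.2 rfl
  refine Finset.sum_eq_single_of_mem _ (mem_INCOn.2 ⟨?_, Finset.empty_subset _⟩) fun p hp hne => ?_
  · intro U hU
    rw [hparts] at hU
    exact absurd hU (Finset.notMem_empty U)
  · refine absurd (Prod.ext (Finpartition.ext ?_) ?_) hne
    · rw [hparts, hparts]
    · rw [Finset.eq_empty_iff_forall_notMem]
      intro U hU
      have := mem_parts_of_mem_INCOn hp hU
      rw [hparts] at this
      exact Finset.notMem_empty U this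

theorem contractionOn_of_eq_empty (E : M → D) (F : List M → Gamma D M) (a : Fin n → M)
    (hI : I = ∅) (π : Finpartition I) : contractionOn E F a (π, ∅) = F [] := by
  have : prefactor E a (π, ∅) = 1 := by
    refine nestedExp_empty E a ?_ _
    subst hI; rfl
  rw [contractionOn, this, Gamma.coeff_one, one_mul, sortByMax_empty, List.map_nil]

/-- The expansion of a monomial in Wick products, for the first `m` positions. -/
theorem sum_contractionOn_wick_positionsBelow [SMulCommClass Dᵐᵒᵖ M M] (E : M → D)
    (hW : ∀ (l : List M) (a : M) (d : D),
      wick E (l ++ [MulOpposite.op d • a]) = wick E (l ++ [a]) * Gamma.coeff M d)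
    (a : Fin n → M) {m : ℕ} (hm : m ≤ n) :
    ∑ p ∈ INCOn (positionsBelow n m), contractionOn E (wick E) a p =
      monomialProd D ((List.ofFn a).take m) := by
  induction m with
  | zero =>
    rw [sum_INCOn_of_eq_empty positionsBelow_zero,
      contractionOn_of_eq_empty E _ a positionsBelow_zero, wick_nil]
    simp [monomialProd]
  | succ m ih =>
    have hk := lt_of_mem_positionsBelow hm
    rw [positionsBelow_succ hm, sum_INCOn_insert hk,
      Finset.sum_congr rfl fun p hp => sum_contractionOn_wick E hW a hk hp, ← Finset.sum_mul,
      ih (Nat.le_of_lt hm), List.take_add_one, monomialProd_append]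
    simp [Nat.lt_of_succ_le hm, monomialProd]

end Sums

/-! ### Wick products as sums of monomials -/

section Inversion

variable {D M : Type*} [Ring D] [Algebra ℂ D] [NonUnitalRing M] [Module D M] [Module Dᵐᵒᵖ M]
variable {n : ℕ} {I : Finset (Fin n)} {k : Fin n}

/-- The index set of the inversion formula: interval partitions whose closed blocks are
singletons. -/
def IsInversionTerm (p : Finpartition I × Finset (Finset (Fin n))) : Prop :=
  IsIntervalPartition p.1 ∧ ∀ U ∈ p.1.parts \ p.2, U.card = 1

/-- The last position of `I` lies in an open block. -/
def LastIsOpen (p : Finpartition I × Finset (Finset (Fin n))) : Prop :=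
  ∃ V ∈ p.2, ∃ m ∈ V, ∀ x ∈ I, x ≤ m

theorem isIntervalPartition_adjoin {π : Finpartition I} (hk : ∀ x ∈ I, x < k)
    {V : Finset (Fin n)} (hV : V = ∅ ∨ V ∈ π.parts) :
    IsIntervalPartition (adjoin π hk V) ↔
      IsIntervalPartition π ∧ (V = ∅ ∨ ∃ m ∈ V, ∀ x ∈ I, x ≤ m) := by
  unfold IsIntervalPartition
  rw [parts_adjoin hk hV]
  have hVI : V ⊆ I := by
    rcases hV with rfl | h
    · exact Finset.empty_subset _
    · exact π.subset h
  constructor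
  · intro h
    have hVk := h _ (Finset.mem_insert_self _ _)
    refine ⟨fun U hU i hi l hl j hj hij hjl => ?_, ?_⟩
    · by_cases hUV : U = V
      · subst hUV
        exact (Finset.mem_insert.1 (hVk i (Finset.mem_insert_of_mem hi) l
          (Finset.mem_insert_of_mem hl) j (Finset.mem_insert_of_mem hj) hij hjl)).resolve_left
          (hk j hj).ne
      · exact h U (Finset.mem_insert_of_mem (Finset.mem_erase.2 ⟨hUV, hU⟩)) i hi l hl j
          (Finset.mem_insert_of_mem hj) hij hjl
    · rcases V.eq_empty_or_nonempty with h0 | h0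
      · exact Or.inl h0
      · refine Or.inr ⟨V.max' h0, V.max'_mem h0, fun x hx => ?_⟩
        by_contra hlt
        have hxV := (Finset.mem_insert.1 (hVk _ (Finset.mem_insert_of_mem (V.max'_mem h0)) k
          (Finset.mem_insert_self _ _) x (Finset.mem_insert_of_mem hx) (not_le.1 hlt).le
          (hk x hx).le)).resolve_left (hk x hx).ne
        exact hlt (V.le_max' x hxV)
  · rintro ⟨h, hm⟩ U hU i hi l hl j hj hij hjl
    rcases Finset.mem_insert.1 hU with rfl | hU
    · rcases Finset.mem_insert.1 hj with rfl | hj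
      · exact Finset.mem_insert_self _ _
      refine Finset.mem_insert_of_mem ?_
      rcases Finset.mem_insert.1 hi with rfl | hi
      · exact absurd (hk j ‹_›) (not_lt.2 hij)
      have hne := Finset.ne_empty_of_mem hi
      obtain ⟨m, hmV, hmax⟩ := hm.resolve_left hne
      exact h V (hV.resolve_left hne) i hi m hmV j hj hij
        (hmax j hj)
    · have hUπ := Finset.mem_of_mem_erase hU
      refine h U hUπ i hi l hl j ((Finset.mem_insert.1 hj).resolve_left ?_) hij hjl
      rintro rfl
      exact absurd (hk l (π.subset hUπ hl)) (not_lt.2 hjl)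

variable {p : Finpartition I × Finset (Finset (Fin n))} {V : Finset (Fin n)}

theorem insert_notMem_of_mem_INCOn (hk : ∀ x ∈ I, x < k) (hp : p ∈ INCOn I) :
    insert k V ∉ p.2 := fun h =>
  lt_irrefl _ (hk k (subset_of_mem_INCOn hp h (Finset.mem_insert_self _ _)))

theorem closedBlocks_extOpen (hk : ∀ x ∈ I, x < k) (hp : p ∈ INCOn I) (hV : IsLastOpen p V) :
    (extOpen hk p V).1.parts \ (extOpen hk p V).2 = p.1.parts \ p.2 := by
  ext U
  simp only [extOpen, parts_adjoin hk (hV.mem_parts hp), Finset.mem_sdiff, Finset.mem_insert,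
    Finset.mem_erase]
  have h₁ : U ∈ p.1.parts → U ≠ insert k V := by
    rintro hU rfl
    exact lt_irrefl _ (hk k (p.1.subset hU (Finset.mem_insert_self _ _)))
  have h₂ : U = V → U ∈ p.1.parts → U ∈ p.2 := by
    rintro rfl hU
    exact (hV.resolve_left (p.1.ne_empty hU)).1
  tauto

theorem closedBlocks_extClosed (hk : ∀ x ∈ I, x < k) (hp : p ∈ INCOn I) (hV : IsLastOpen p V) :
    (extClosed hk p V).1.parts \ (extClosed hk p V).2 =
      insert (insert k V) (p.1.parts \ p.2) := by
  ext U
  simp only [extClosed, parts_adjoin hk (hV.mem_parts hp), Finset.mem_sdiff, Finset.mem_insert,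
    Finset.mem_erase]
  have h₁ : U = insert k V → U ∉ p.2 := by
    rintro rfl
    exact insert_notMem_of_mem_INCOn hk hp
  have h₂ : U = V → U ∈ p.1.parts → U ∈ p.2 := by
    rintro rfl hU
    exact (hV.resolve_left (p.1.ne_empty hU)).1
  tauto

/-- The new block is an interval exactly if it is a singleton or extends a block that ends at the
previous position. -/
theorem isInversionTerm_extOpen (hk : ∀ x ∈ I, x < k) (hp : p ∈ INCOn I)
    (hV : IsLastOpen p V) : IsInversionTerm (extOpen hk p V) ↔
      IsInversionTerm p ∧ (V = ∅ ∨ LastIsOpen p) := by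
  have h := isIntervalPartition_adjoin hk (hV.mem_parts hp)
  have hlast : (V = ∅ ∨ ∃ m ∈ V, ∀ x ∈ I, x ≤ m) ↔ V = ∅ ∨ LastIsOpen p := by
    refine or_congr_right' fun hne => ?_
    obtain ⟨hVp, hVmax⟩ := hV.resolve_left hne
    refine ⟨fun ⟨m, hm, hmax⟩ => ⟨V, hVp, m, hm, hmax⟩, fun ⟨U, hU, m, hm, hmax⟩ => ?_⟩
    by_cases hUV : U = V
    · exact ⟨m, hUV ▸ hm, hmax⟩
    · obtain ⟨x, hx⟩ := Finset.nonempty_iff_ne_empty.2 hne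
      exact absurd (hmax x (hV.subset hp hx)) (not_le.2 (hV.lt hp hU hUV m hm x hx))
  rw [IsInversionTerm, closedBlocks_extOpen hk hp hV]
  change IsIntervalPartition (adjoin p.1 hk V) ∧ _ ↔ _
  rw [h, hlast]
  exact and_right_comm

theorem isInversionTerm_extClosed (hk : ∀ x ∈ I, x < k) (hp : p ∈ INCOn I)
    (hV : IsLastOpen p V) : IsInversionTerm (extClosed hk p V) ↔
      IsInversionTerm p ∧ V = ∅ := by
  have hkV : k ∉ V := fun h => lt_irrefl _ (hk k (hV.subset hp h))
  have hcard : (insert k V).card = 1 ↔ V = ∅ := by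
    rw [Finset.card_insert_of_notMem hkV, Nat.add_eq_right, Finset.card_eq_zero]
  rw [IsInversionTerm, closedBlocks_extClosed hk hp hV]
  change IsIntervalPartition (adjoin p.1 hk V) ∧ _ ↔ _
  rw [isIntervalPartition_adjoin hk (hV.mem_parts hp), Finset.forall_mem_insert, hcard]
  exact ⟨fun h => ⟨⟨h.1.1, h.2.2⟩, h.2.1⟩, fun h => ⟨⟨h.1.1, Or.inl h.2⟩, h.2, h.1.2⟩⟩

theorem lastIsOpen_extOpen (hk : ∀ x ∈ I, x < k) : LastIsOpen (extOpen hk p V) := by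
  refine ⟨insert k V, Finset.mem_insert_self _ _, k, Finset.mem_insert_self _ _, fun x hx => ?_⟩
  rcases Finset.mem_insert.1 hx with rfl | hx
  · exact le_rfl
  · exact (hk x hx).le

theorem not_lastIsOpen_extClosed (hk : ∀ x ∈ I, x < k) (hp : p ∈ INCOn I) :
    ¬ LastIsOpen (extClosed hk p V) := by
  rintro ⟨U, hU, m, hm, hmax⟩
  have hmI := subset_of_mem_INCOn hp (Finset.mem_of_mem_erase hU) hm
  exact absurd (hmax k (Finset.mem_insert_self _ _)) (not_le.2 (hk m hmI))

theorem card_le_of_mem_INCOn (hp : p ∈ INCOn I) : p.2.card ≤ I.card :=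
  (Finset.card_le_card fun _ hU => mem_parts_of_mem_INCOn hp hU).trans p.1.card_parts_le_card

theorem card_extOpen (hk : ∀ x ∈ I, x < k) (hp : p ∈ INCOn I) :
    (extOpen hk p V).2.card = (p.2.erase V).card + 1 :=
  Finset.card_insert_of_notMem fun h =>
    insert_notMem_of_mem_INCOn hk hp (Finset.mem_of_mem_erase h)

theorem card_insert_last (hk : ∀ x ∈ I, x < k) : (insert k I).card = I.card + 1 :=
  Finset.card_insert_of_notMem fun h => lt_irrefl _ (hk k h)

/-- The value at `b₁ ⊗ ⋯ ⊗ b_ℓ` of the partially summed inversion formula when the last position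
read so far is open and `rest` is still to be read: that position is the end of an argument `b_ℓ`
that the next position can still extend. -/
noncomputable def pendingTerm (E : M → D) (rest : List M) (l : List M) : Gamma D M :=
  match l.reverse with
  | [] => wick E rest
  | t :: r => monomialProd D r.reverse * (wick E (t :: rest) + Gamma.coeff M (E t) * wick E rest)

theorem pendingTerm_append (E : M → D) (rest l : List M) (t : M) :
    pendingTerm E rest (l ++ [t]) =
      monomialProd D l * (wick E (t :: rest) + Gamma.coeff M (E t) * wick E rest) := by
  simp [pendingTerm]

theorem pendingTerm_nil_eq (E : M → D) : pendingTerm E ([] : List M) = monomialProd D := by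
  funext l
  rcases List.eq_nil_or_concat' l with rfl | ⟨l, t, rfl⟩
  · simp [pendingTerm, wick_nil, monomialProd]
  · rw [pendingTerm_append, wick_nil, wick_singleton, monomialProd_append, monomialProd_singleton]
    noncomm_ring

open Classical in
/-- The signed contribution of `p` to the inversion formula, when the positions of `p` have been
read and `rest` is still to be read. -/
noncomputable def inversionTerm (E : M → D) (a : Fin n → M) (rest : List M)
    (p : Finpartition I × Finset (Finset (Fin n))) : Gamma D M :=
  if IsInversionTerm p then
    (-1 : Gamma D M) ^ (I.card - p.2.card) *
      (if LastIsOpen p then contractionOn E (pendingTerm E rest) a p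
        else contractionOn E (monomialProd D) a p * wick E rest)
  else 0

theorem monomialProd_op_smul (l : List M) (a : M) (d : D) :
    monomialProd D (l ++ [MulOpposite.op d • a]) = monomialProd D (l ++ [a]) * Gamma.coeff M d := by
  rw [monomialProd_append, monomialProd_append, monomialProd_singleton, monomialProd_singleton,
    Gamma.X_op_smul, mul_assoc]

theorem monomialProd_nil : monomialProd D ([] : List M) = 1 := by
  simp [monomialProd]

/-- Reading one more position does not change the partially summed inversion formula; this is the
mirror image of the four-term recursion. -/
theorem sum_inversionTerm [SMulCommClass Dᵐᵒᵖ M M] (E : M → D) (a : Fin n → M)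
    (hk : ∀ x ∈ I, x < k) (hp : p ∈ INCOn I) (rest : List M) :
    ∑ V ∈ ({∅, topBlock p.2} : Finset (Finset (Fin n))),
        (inversionTerm E a rest (extOpen hk p V) + inversionTerm E a rest (extClosed hk p V)) =
      inversionTerm E a (a k :: rest) p := by
  have hle := card_le_of_mem_INCOn hp
  have hnl : ∀ V, ¬ LastIsOpen (extClosed hk p V) := fun V => not_lastIsOpen_extClosed hk hp
  by_cases hQ : IsInversionTerm p
  swap
  · rw [inversionTerm, if_neg hQ]
    refine Finset.sum_eq_zero fun V hV => ?_
    have hV := eq_empty_or_mem_of_mem_pair hp hV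
    rw [inversionTerm, inversionTerm, if_neg, if_neg, add_zero]
    · rw [isInversionTerm_extClosed hk hp hV]; tauto
    · rw [isInversionTerm_extOpen hk hp hV]; tauto
  -- a new block, open or closed
  have h₁ : inversionTerm E a rest (extOpen hk p ∅) + inversionTerm E a rest (extClosed hk p ∅) =
      (-1 : Gamma D M) ^ (I.card - p.2.card) *
        (contractionOn E (monomialProd D) a p * wick E (a k :: rest)) := by
    rw [inversionTerm, inversionTerm, if_pos, if_pos (lastIsOpen_extOpen hk), if_pos,
      if_neg (hnl ∅), contractionOn_extOpen_empty E _ a hk hp,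
      contractionOn_extClosed_empty E a monomialProd_nil monomialProd_op_smul hk hp,
      pendingTerm_append, card_extOpen hk hp, card_insert_last hk, erase_empty_of_mem_INCOn hp,
      Nat.add_sub_add_right]
    · have hc : (extClosed hk p ∅).2.card = p.2.card := by
        rw [extClosed, erase_empty_of_mem_INCOn hp]
      rw [hc, Nat.sub_add_comm hle, pow_succ, contractionOn]
      noncomm_ring
    · exact (isInversionTerm_extClosed hk hp (Or.inl rfl)).2 ⟨hQ, rfl⟩
    · exact (isInversionTerm_extOpen hk hp (Or.inl rfl)).2 ⟨hQ, Or.inl rfl⟩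
  rw [inversionTerm, if_pos hQ]
  rcases p.2.eq_empty_or_nonempty with hS | hS
  · have htop : topBlock p.2 = ∅ := by rw [hS, topBlock_empty]
    rw [htop, Finset.pair_eq_singleton, Finset.sum_singleton, h₁, if_neg]
    rintro ⟨V, hV, -⟩
    rw [hS] at hV
    exact Finset.notMem_empty V hV
  · have htop := isLastOpen_topBlock hp hS
    have hne := topBlock_ne_empty hp hS
    have hclosed : inversionTerm E a rest (extClosed hk p (topBlock p.2)) = 0 := by
      rw [inversionTerm, if_neg]
      rw [isInversionTerm_extClosed hk hp htop]; tauto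
    rw [sum_topBlock hp hS, h₁, hclosed, add_zero]
    by_cases hL : LastIsOpen p
    · rw [if_pos hL, inversionTerm, if_pos, if_pos (lastIsOpen_extOpen hk),
        contractionOn_extOpen E _ a hk hp htop, pendingTerm_append, card_extOpen hk hp,
        card_insert_last hk, Finset.card_erase_add_one (topBlock_spec hp hS).1,
        Nat.sub_add_comm hle, pow_succ, joinFactor_topBlock E a hp hS, contractionOn,
        contractionOn, sortByMax_eq_append_topBlock hp hS, List.map_append, List.map_singleton,
        pendingTerm_append, monomialProd_append, monomialProd_singleton,
        wick_cons_cons E (openFactor E a p (topBlock p.2))]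
      · noncomm_ring
      · exact (isInversionTerm_extOpen hk hp htop).2 ⟨hQ, Or.inr hL⟩
    · rw [if_neg hL, inversionTerm, if_neg, add_zero]
      rw [isInversionTerm_extOpen hk hp htop]; tauto

/-- The partially summed inversion formula equals the Wick product for every number `m` of positions
read: at `m = 0` it is the Wick product itself, at `m = n` the signed sum over monomials. -/
theorem sum_inversionTerm_positionsBelow [SMulCommClass Dᵐᵒᵖ M M] (E : M → D) (a : Fin n → M)
    {m : ℕ} (hm : m ≤ n) :
    ∑ p ∈ INCOn (positionsBelow n m), inversionTerm E a ((List.ofFn a).drop m) p =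
      wick E (List.ofFn a) := by
  induction m with
  | zero =>
    have hI := positionsBelow_zero (n := n)
    have hQ : IsInversionTerm (I := positionsBelow n 0) (⊥, ∅) := by
      have hparts : (⊥ : Finpartition (positionsBelow n 0)).parts = ∅ :=
        Finpartition.parts_eq_empty_iff.2 hI
      refine ⟨fun U hU => ?_, fun U hU => ?_⟩
      · rw [hparts] at hU
        exact absurd hU (Finset.notMem_empty U)
      · have hU := (Finset.mem_sdiff.1 hU).1
        rw [hparts] at hU
        exact absurd hU (Finset.notMem_empty U)
    rw [sum_INCOn_of_eq_empty hI, inversionTerm, if_pos hQ, if_neg,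
      contractionOn_of_eq_empty E _ a hI, monomialProd_nil]
    · simp [hI]
    · rintro ⟨V, hV, -⟩
      exact Finset.notMem_empty V hV
  | succ m ih =>
    have hk := lt_of_mem_positionsBelow hm
    rw [positionsBelow_succ hm, sum_INCOn_insert hk,
      Finset.sum_congr rfl fun p hp => sum_inversionTerm E a hk hp _]
    rw [← ih (Nat.le_of_lt hm)]
    have hlen : m < (List.ofFn a).length := by simpa using hm
    rw [List.drop_eq_getElem_cons hlen]
    simp

end Inversion

/-! ### Products of Wick products -/

section Products

variable {D M : Type*} [Ring D] [Algebra ℂ D] [NonUnitalRing M] [Module D M] [Module Dᵐᵒᵖ M]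
variable {n : ℕ} {I : Finset (Fin n)} {k : Fin n} {ι : Type*}

/-- Each block has at most one element from each class `idx ⁻¹ {i}`, and all one-element blocks are
open. -/
def IsSeparated (idx : Fin n → ι) (p : Finpartition I × Finset (Finset (Fin n))) : Prop :=
  (∀ U ∈ p.1.parts, ∀ i ∈ U, ∀ j ∈ U, idx i = idx j → i = j) ∧ singletonBlocks p.1 ⊆ p.2

/-- Some open block has an element in position `K` or later. -/
def IsOpenFrom (K : ℕ) (p : Finpartition I × Finset (Finset (Fin n))) : Prop :=
  ∃ U ∈ p.2, ∃ x ∈ U, K ≤ x.val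

variable {p : Finpartition I × Finset (Finset (Fin n))} {V : Finset (Fin n)}

theorem injOn_parts_adjoin {π : Finpartition I} (idx : Fin n → ι) (hk : ∀ x ∈ I, x < k)
    (hV : V = ∅ ∨ V ∈ π.parts) :
    (∀ U ∈ (adjoin π hk V).parts, ∀ i ∈ U, ∀ j ∈ U, idx i = idx j → i = j) ↔
      (∀ U ∈ π.parts, ∀ i ∈ U, ∀ j ∈ U, idx i = idx j → i = j) ∧ ∀ x ∈ V, idx x ≠ idx k := by
  rw [parts_adjoin hk hV]
  have hkV : k ∉ V := by
    rcases hV with rfl | h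
    · exact Finset.notMem_empty k
    · exact fun hkV => lt_irrefl _ (hk k (π.subset h hkV))
  constructor
  · intro h
    have hVk := h _ (Finset.mem_insert_self _ _)
    refine ⟨fun U hU i hi j hj => ?_, fun x hx hxk => ?_⟩
    · by_cases hUV : U = V
      · subst hUV
        exact hVk i (Finset.mem_insert_of_mem hi) j (Finset.mem_insert_of_mem hj)
      · exact h U (Finset.mem_insert_of_mem (Finset.mem_erase.2 ⟨hUV, hU⟩)) i hi j hj
    · have := hVk x (Finset.mem_insert_of_mem hx) k (Finset.mem_insert_self _ _) hxk
      exact hkV (this ▸ hx)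
  · rintro ⟨h, hne⟩ U hU i hi j hj hij
    rcases Finset.mem_insert.1 hU with rfl | hU'
    · rcases Finset.mem_insert.1 hi with hi' | hi' <;> rcases Finset.mem_insert.1 hj with hj' | hj'
      · rw [hi', hj']
      · exact absurd (hij ▸ congrArg idx hi') (hne j hj')
      · exact absurd (hij.trans (congrArg idx hj')) (hne i hi')
      · exact h V (hV.resolve_left (Finset.ne_empty_of_mem hi')) i hi' j hj' hij
    · exact h U (Finset.mem_of_mem_erase hU') i hi j hj hij

theorem mem_singletonBlocks {π : Finpartition I} {U : Finset (Fin n)} :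
    U ∈ singletonBlocks π ↔ U ∈ π.parts ∧ U.card = 1 := by
  simp [singletonBlocks]

theorem isSeparated_extOpen (idx : Fin n → ι) (hk : ∀ x ∈ I, x < k) (hp : p ∈ INCOn I)
    (hV : IsLastOpen p V) : IsSeparated idx (extOpen hk p V) ↔
      IsSeparated idx p ∧ ∀ x ∈ V, idx x ≠ idx k := by
  have h := injOn_parts_adjoin idx hk (hV.mem_parts hp)
  have hs : singletonBlocks (extOpen hk p V).1 ⊆ (extOpen hk p V).2 ↔
      singletonBlocks p.1 ⊆ p.2 := by
    constructor
    · intro hs U hU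
      obtain ⟨hU, hU1⟩ := mem_singletonBlocks.1 hU
      by_cases hUV : U = V
      · subst hUV
        exact (hV.resolve_left (p.1.ne_empty hU)).1
      have hU' : U ∈ (extOpen hk p V).2 := by
        refine hs (mem_singletonBlocks.2 ⟨?_, hU1⟩)
        change U ∈ (adjoin p.1 hk V).parts
        rw [parts_adjoin hk (hV.mem_parts hp)]
        exact Finset.mem_insert_of_mem (Finset.mem_erase.2 ⟨hUV, hU⟩)
      rcases Finset.mem_insert.1 hU' with rfl | hU'
      · exact absurd (hk k (p.1.subset hU (Finset.mem_insert_self _ _))) (lt_irrefl k)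
      · exact Finset.mem_of_mem_erase hU'
    · intro hs U hU
      obtain ⟨hU, hU1⟩ := mem_singletonBlocks.1 hU
      change U ∈ (adjoin p.1 hk V).parts at hU
      rw [parts_adjoin hk (hV.mem_parts hp)] at hU
      rcases Finset.mem_insert.1 hU with rfl | hU
      · exact Finset.mem_insert_self _ _
      · obtain ⟨hUV, hU⟩ := Finset.mem_erase.1 hU
        exact Finset.mem_insert_of_mem
          (Finset.mem_erase.2 ⟨hUV, hs (mem_singletonBlocks.2 ⟨hU, hU1⟩)⟩)
  rw [IsSeparated, hs]
  change (∀ U ∈ (adjoin p.1 hk V).parts, _) ∧ _ ↔ _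
  rw [h]
  exact and_right_comm

theorem isSeparated_extClosed (idx : Fin n → ι) (hk : ∀ x ∈ I, x < k) (hp : p ∈ INCOn I)
    (hV : IsLastOpen p V) : IsSeparated idx (extClosed hk p V) ↔
      IsSeparated idx p ∧ V ≠ ∅ ∧ ∀ x ∈ V, idx x ≠ idx k := by
  have hopen := isSeparated_extOpen idx hk hp hV
  have hnot : insert k V ∉ p.2.erase V := fun h =>
    insert_notMem_of_mem_INCOn hk hp (Finset.mem_of_mem_erase h)
  have hkV : k ∉ V := fun h => lt_irrefl _ (hk k (hV.subset hp h))
  have hcard : (insert k V).card = 1 ↔ V = ∅ := by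
    rw [Finset.card_insert_of_notMem hkV, Nat.add_eq_right, Finset.card_eq_zero]
  have hmem : insert k V ∈ (adjoin p.1 hk V).parts := by
    rw [parts_adjoin hk (hV.mem_parts hp)]
    exact Finset.mem_insert_self _ _
  have hs : singletonBlocks (adjoin p.1 hk V) ⊆ p.2.erase V ↔
      singletonBlocks (adjoin p.1 hk V) ⊆ insert (insert k V) (p.2.erase V) ∧ V ≠ ∅ := by
    constructor
    · refine fun h => ⟨h.trans (Finset.subset_insert _ _), fun h0 => hnot (h ?_)⟩
      exact mem_singletonBlocks.2 ⟨hmem, hcard.2 h0⟩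
    · rintro ⟨h, hne⟩ U hU
      refine (Finset.mem_insert.1 (h hU)).resolve_left ?_
      rintro rfl
      exact hne (hcard.1 (mem_singletonBlocks.1 hU).2)
  have h₁ : IsSeparated idx (extClosed hk p V) ↔
      IsSeparated idx (extOpen hk p V) ∧ V ≠ ∅ := by
    rw [IsSeparated, IsSeparated, and_assoc]
    exact and_congr_right fun _ => hs
  rw [h₁, hopen]
  exact ⟨fun h => ⟨h.1.1, h.2, h.1.2⟩, fun h => ⟨⟨h.1, h.2.2⟩, h.2.1⟩⟩

open Classical in
/-- The contribution of `p` to the product formula, when the positions of `p` have been read, the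
current factor `W` began at position `K`, and the arguments `rest` of this factor are still to be
read. If no position of the current factor lies in an open block, the rest of the factor is still to
be multiplied; otherwise no further contraction is possible, and the rest is appended. -/
noncomputable def productTerm (E : M → D) (a : Fin n → M) (idx : Fin n → ι) (K : ℕ)
    (rest : List M) (p : Finpartition I × Finset (Finset (Fin n))) : Gamma D M :=
  if IsSeparated idx p then
    if IsOpenFrom K p then contractionOn E (fun l => wick E (l ++ rest)) a p
    else contractionOn E (wick E) a p * wick E rest
  else 0

/-- Reading one more position of the current factor does not change the partially summed product
formula. If no position of this factor is open yet, this is the expansion of a product of two Wick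
products; otherwise `k` can only form a new open block. -/
theorem sum_productTerm [SMulCommClass Dᵐᵒᵖ M M] (E : M → D)
    (hW : ∀ (l : List M) (a : M) (d : D),
      wick E (l ++ [MulOpposite.op d • a]) = wick E (l ++ [a]) * Gamma.coeff M d)
    (a : Fin n → M) (idx : Fin n → ι) (hk : ∀ x ∈ I, x < k) (hp : p ∈ INCOn I) {K : ℕ}
    (hK : K ≤ k.val) (hidx : ∀ x ∈ I, idx x = idx k ↔ K ≤ x.val) (rest : List M) :
    ∑ V ∈ ({∅, topBlock p.2} : Finset (Finset (Fin n))),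
        (productTerm E a idx K rest (extOpen hk p V) +
          productTerm E a idx K rest (extClosed hk p V)) =
      productTerm E a idx K (a k :: rest) p := by
  have hopen : ∀ V, IsOpenFrom K (extOpen hk p V) := fun V =>
    ⟨insert k V, Finset.mem_insert_self _ _, k, Finset.mem_insert_self _ _, hK⟩
  by_cases hQ : IsSeparated idx p
  swap
  · rw [productTerm, if_neg hQ]
    refine Finset.sum_eq_zero fun V hV => ?_
    have hV := eq_empty_or_mem_of_mem_pair hp hV
    rw [productTerm, productTerm, if_neg, if_neg, add_zero]
    · rw [isSeparated_extClosed idx hk hp hV]; tauto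
    · rw [isSeparated_extOpen idx hk hp hV]; tauto
  have h₁ : productTerm E a idx K rest (extOpen hk p ∅) +
      productTerm E a idx K rest (extClosed hk p ∅) =
      contractionOn E (fun l => wick E (l ++ a k :: rest)) a p := by
    have hcl : ¬ IsSeparated idx (extClosed hk p ∅) := fun h =>
      ((isSeparated_extClosed idx hk hp (Or.inl rfl)).1 h).2.1 rfl
    rw [productTerm, productTerm, if_neg hcl, add_zero, if_pos, if_pos (hopen ∅),
      contractionOn_extOpen_empty E _ a hk hp, contractionOn, List.append_assoc,
      List.singleton_append]
    exact (isSeparated_extOpen idx hk hp (Or.inl rfl)).2 ⟨hQ, by simp⟩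
  rw [productTerm, if_pos hQ]
  rcases p.2.eq_empty_or_nonempty with hS | hS
  · have htop : topBlock p.2 = ∅ := by rw [hS, topBlock_empty]
    rw [htop, Finset.pair_eq_singleton, Finset.sum_singleton, h₁, if_neg, contractionOn,
      contractionOn, hS, sortByMax_empty, List.map_nil, List.nil_append, wick_nil, mul_one]
    rintro ⟨U, hU, -⟩
    rw [hS] at hU
    exact Finset.notMem_empty U hU
  · have htop := isLastOpen_topBlock hp hS
    have hne := topBlock_ne_empty hp hS
    obtain ⟨hVp, hVmax⟩ := topBlock_spec hp hS
    -- the last open block has the largest maximum, so it meets the current factor if any open block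
    -- does
    have hfrom : (∀ x ∈ topBlock p.2, idx x ≠ idx k) ↔ ¬ IsOpenFrom K p := by
      constructor
      · rintro h ⟨U, hU, x, hx, hKx⟩
        obtain ⟨m, hm⟩ := Finset.max_of_nonempty (Finset.nonempty_iff_ne_empty.2 hne)
        have hmV := Finset.mem_of_max hm
        have hxm : x ≤ m :=
          WithBot.coe_le_coe.1 ((Finset.le_max hx).trans ((hVmax U hU).trans hm.le))
        exact h m hmV ((hidx m (htop.subset hp hmV)).2 (hKx.trans hxm))
      · intro h x hx hxk
        exact h ⟨_, hVp, x, hx, (hidx x (htop.subset hp hx)).1 hxk⟩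
    have hQo := isSeparated_extOpen idx hk hp htop
    have hQc := isSeparated_extClosed idx hk hp htop
    rw [hfrom] at hQo hQc
    rw [sum_topBlock hp hS, h₁]
    by_cases hL : IsOpenFrom K p
    · rw [if_pos hL, productTerm, productTerm, if_neg, if_neg, add_zero, add_zero]
      · rw [hQc]; tauto
      · rw [hQo]; tauto
    · have hL' : ¬ IsOpenFrom K (extClosed hk p (topBlock p.2)) := by
        rintro ⟨U, hU, x, hx, hKx⟩
        exact hL ⟨U, Finset.mem_of_mem_erase hU, x, hx, hKx⟩
      rw [if_neg hL, productTerm, productTerm, if_pos (hQo.2 ⟨hQ, hL⟩), if_pos (hopen _),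
        if_pos (hQc.2 ⟨hQ, hne, hL⟩), if_neg hL', contractionOn_extOpen E _ a hk hp htop,
        contractionOn_extClosed E a (wick_nil E) hW hk hp htop, joinFactor_topBlock E a hp hS,
        contractionOn, contractionOn, sortByMax_eq_append_topBlock hp hS, List.map_append,
        List.map_singleton, List.append_assoc, List.append_assoc, List.singleton_append,
        List.singleton_append, mul_assoc _ (wick E _) (wick E (a k :: rest)),
        wick_append_mul_wick_cons]
      noncomm_ring

open Classical in
/-- The right-hand side of the product formula for the first `m` positions. -/
noncomputable def separatedSum (E : M → D) (a : Fin n → M) (idx : Fin n → ι) (m : ℕ) :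
    Gamma D M :=
  ∑ p ∈ INCOn (positionsBelow n m),
    if IsSeparated idx p then contractionOn E (wick E) a p else 0

/-- Reading one factor of the product formula, whose positions are `K, …, K + l.length - 1`. -/
theorem separatedSum_add [SMulCommClass Dᵐᵒᵖ M M] (E : M → D)
    (hW : ∀ (l : List M) (a : M) (d : D),
      wick E (l ++ [MulOpposite.op d • a]) = wick E (l ++ [a]) * Gamma.coeff M d)
    (a : Fin n → M) (idx : Fin n → ι) {K : ℕ} {l : List M} (hKn : K + l.length ≤ n)
    (hl : ∀ t (ht : t < l.length), l[t] = a ⟨K + t, by omega⟩)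
    (hidx : ∀ x y : Fin n, K ≤ y.val → y.val < K + l.length → x < y →
      (idx x = idx y ↔ K ≤ x.val)) :
    separatedSum E a idx (K + l.length) = separatedSum E a idx K * wick E l := by
  have key : ∀ t ≤ l.length, ∑ p ∈ INCOn (positionsBelow n (K + t)),
      productTerm E a idx K (l.drop t) p = separatedSum E a idx K * wick E l := by
    intro t
    induction t with
    | zero =>
      intro _
      rw [separatedSum, Finset.sum_mul]
      refine Finset.sum_congr rfl fun p hp => ?_
      have hL : ¬ IsOpenFrom K p := by
        rintro ⟨U, hU, x, hx, hKx⟩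
        exact absurd (mem_positionsBelow.1 (subset_of_mem_INCOn hp hU hx)) (not_lt.2 hKx)
      rw [productTerm, if_neg hL, List.drop_zero, ite_mul, zero_mul]
    | succ t ih =>
      intro ht
      have hkn : K + t < n := by omega
      have hk := lt_of_mem_positionsBelow hkn
      rw [← ih (Nat.le_of_lt ht), ← add_assoc, positionsBelow_succ hkn, sum_INCOn_insert hk,
        List.drop_eq_getElem_cons ht, hl t ht]
      refine Finset.sum_congr rfl fun p hp => ?_
      refine sum_productTerm E hW a idx hk hp (Nat.le_add_right K t) (fun x hx => ?_) _
      exact hidx x _ (Nat.le_add_right K t) (Nat.add_lt_add_left ht K) (hk x hx)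
  rw [← key l.length le_rfl, separatedSum]
  refine Finset.sum_congr rfl fun p _ => ?_
  simp only [productTerm, List.drop_length, List.append_nil, wick_nil, mul_one, ite_self]

theorem separatedSum_zero (E : M → D) (a : Fin n → M) (idx : Fin n → ι) :
    separatedSum E a idx 0 = 1 := by
  have hI := positionsBelow_zero (n := n)
  have hparts : (⊥ : Finpartition (positionsBelow n 0)).parts = ∅ :=
    Finpartition.parts_eq_empty_iff.2 hI
  rw [separatedSum, sum_INCOn_of_eq_empty hI, if_pos, contractionOn_of_eq_empty E _ a hI, wick_nil]
  refine ⟨fun U hU => ?_, fun U hU => ?_⟩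
  · rw [hparts] at hU
    exact absurd hU (Finset.notMem_empty U)
  · have hU := (mem_singletonBlocks.1 hU).1
    rw [hparts] at hU
    exact absurd hU (Finset.notMem_empty U)

/-- The product formula for the first `m` factors of a composition. -/
theorem separatedSum_composition [SMulCommClass Dᵐᵒᵖ M M] (E : M → D)
    (hW : ∀ (l : List M) (a : M) (d : D),
      wick E (l ++ [MulOpposite.op d • a]) = wick E (l ++ [a]) * Gamma.coeff M d)
    (a : Fin n → M) (c : Composition n) {m : ℕ} (hm : m ≤ c.length) :
    separatedSum E a c.index (c.sizeUpTo m) =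
      ((List.ofFn fun i : Fin c.length =>
        wick E (List.ofFn fun j : Fin (c.blocksFun i) => a (c.embedding i j))).take m).prod := by
  induction m with
  | zero => rw [Composition.sizeUpTo_zero, separatedSum_zero, List.take_zero, List.prod_nil]
  | succ m ih =>
    have hsize : c.sizeUpTo (m + 1) = c.sizeUpTo m + c.blocksFun ⟨m, hm⟩ :=
      c.sizeUpTo_succ' ⟨m, hm⟩
    have hmem : ∀ x : Fin n, c.index x = ⟨m, hm⟩ ↔
        c.sizeUpTo m ≤ x.val ∧ x.val < c.sizeUpTo (m + 1) := by
      intro x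
      rw [eq_comm, ← c.mem_range_embedding_iff', c.mem_range_embedding_iff]
    have h := separatedSum_add E hW a c.index (K := c.sizeUpTo m)
      (l := List.ofFn fun j : Fin (c.blocksFun ⟨m, hm⟩) => a (c.embedding ⟨m, hm⟩ j))
      (by rw [List.length_ofFn, ← hsize]; exact c.sizeUpTo_le _)
      (by
        intro t ht
        rw [List.getElem_ofFn]
        rfl)
      (by
        intro x y hy hy' hxy
        rw [List.length_ofFn, ← hsize] at hy'
        rw [(hmem y).2 ⟨hy, hy'⟩, hmem x]
        exact ⟨And.left, fun hx => ⟨hx, (Fin.lt_def.1 hxy).trans hy'⟩⟩)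
    rw [List.length_ofFn, ← hsize] at h
    rw [h, ih (Nat.le_of_lt hm), List.take_add_one, List.prod_append]
    simp [Nat.lt_of_succ_le hm]

theorem mem_part_blockPartition (c : Composition n) (i j : Fin n) :
    j ∈ (blockPartition c).part i ↔ c.index i = c.index j :=
  @Finpartition.mem_part_ofSetoid_iff_rel (Fin n) _ i _ (Setoid.ker c.index)
    (fun i j => decEq (c.index i) (c.index j)) j

theorem inf_blockPartition_eq_bot_iff (c : Composition n)
    (π : Finpartition (Finset.univ : Finset (Fin n))) :
    π ⊓ blockPartition c = ⊥ ↔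
      ∀ U ∈ π.parts, ∀ i ∈ U, ∀ j ∈ U, c.index i = c.index j → i = j := by
  have hrel : ∀ W ∈ (blockPartition c).parts, ∀ i ∈ W, ∀ j ∈ W, c.index i = c.index j := by
    intro W hW i hi j hj
    rw [← (blockPartition c).part_eq_of_mem hW hi] at hj
    exact (mem_part_blockPartition c i j).1 hj
  constructor
  · intro h U hU i hi j hj hij
    have hjW : j ∈ (blockPartition c).part i := (mem_part_blockPartition c i j).2 hij
    have hiW : i ∈ (blockPartition c).part i := (mem_part_blockPartition c i i).2 rfl
    have hmem : U ∩ (blockPartition c).part i ∈ (π ⊓ blockPartition c).parts := by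
      rw [Finpartition.parts_inf, Finset.mem_erase, Finset.mem_image]
      refine ⟨Finset.ne_empty_of_mem (Finset.mem_inter.2 ⟨hi, hiW⟩),
        (U, (blockPartition c).part i), Finset.mem_product.2 ⟨hU, ?_⟩, rfl⟩
      exact (blockPartition c).part_mem.2 (Finset.mem_univ i)
    rw [h, Finpartition.mem_bot_iff] at hmem
    obtain ⟨x, -, hx⟩ := hmem
    have hi' : i ∈ ({x} : Finset (Fin n)) := hx ▸ Finset.mem_inter.2 ⟨hi, hiW⟩
    have hj' : j ∈ ({x} : Finset (Fin n)) := hx ▸ Finset.mem_inter.2 ⟨hj, hjW⟩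
    rw [Finset.mem_singleton.1 hi', Finset.mem_singleton.1 hj']
  · intro h
    refine le_bot_iff.1 fun B hB => ?_
    rw [Finpartition.parts_inf, Finset.mem_erase, Finset.mem_image] at hB
    obtain ⟨hne, ⟨U, W⟩, hUW, rfl⟩ := hB
    obtain ⟨hU, hW⟩ := Finset.mem_product.1 hUW
    obtain ⟨i, hi⟩ := Finset.nonempty_iff_ne_empty.2 hne
    obtain ⟨hiU, hiW⟩ := Finset.mem_inter.1 hi
    refine ⟨{i}, Finpartition.mem_bot_iff.2 ⟨i, Finset.mem_univ i, rfl⟩, fun j hj => ?_⟩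
    obtain ⟨hjU, hjW⟩ := Finset.mem_inter.1 hj
    exact Finset.mem_singleton.2 (h U hU j hjU i hiU (hrel W hW j hjW i hiW))

end Products

theorem mainTheorem7 {D M : Type*} [Ring D] [Algebra ℂ D]
    [NonUnitalRing M] [Module ℂ M] [IsScalarTower ℂ M M] [SMulCommClass ℂ M M]
    [Module D M] [Module Dᵐᵒᵖ M] [IsScalarTower ℂ D M] [IsScalarTower ℂ Dᵐᵒᵖ M]
    [SMulCommClass D Dᵐᵒᵖ M] [IsScalarTower D M M] [SMulCommClass Dᵐᵒᵖ M M]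
    (hmid : ∀ (a b : M) (d : D), (MulOpposite.op d • a) * b = a * (d • b))
    (E : M →ₗ[ℂ] D) (hE_left : ∀ (d : D) (a : M), E (d • a) = d * E a)
    (hE_right : ∀ (a : M) (d : D), E (MulOpposite.op d • a) = E a * d) :
    IsTensorBimoduleMap (D := D) (wick (D := D) (E : M → D)) ∧
    ∀ (n : ℕ) (a : Fin n → M),
      (monomialProd D (List.ofFn a) = ∑ p ∈ INC n, contraction E (wick E) a p) ∧
      (wick E (List.ofFn a) =
        ∑ p ∈ INC n with IsIntervalPartition p.1 ∧ ∀ U ∈ p.1.parts \ p.2, U.card = 1,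
          (-1 : Gamma D M) ^ (n - p.2.card) * contraction E (monomialProd D) a p) ∧
      (∀ c : Composition n,
        (List.ofFn fun i : Fin c.length =>
            wick E (List.ofFn fun j : Fin (c.blocksFun i) => a (c.embedding i j))).prod =
          ∑ p ∈ INC n with p.1 ⊓ blockPartition c = ⊥ ∧ singletonBlocks p.1 ⊆ p.2,
            contraction E (wick E) a p) := by
  have hbim := isTensorBimoduleMap_wick (E : M → D) hmid (map_add E) hE_left hE_right
  refine ⟨hbim, fun n a => ?_⟩
  have hINC : INC n = INCOn (Finset.univ : Finset (Fin n)) := by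
    ext p; simp [INC, INCOn]
  rw [hINC]
  refine ⟨?_, ?_, fun c => ?_⟩
  · have h := sum_contractionOn_wick_positionsBelow (E : M → D) hbim.map_right a le_rfl
    rw [positionsBelow_self, List.take_of_length_le (by simp)] at h
    exact h.symm
  · have h := sum_inversionTerm_positionsBelow (E : M → D) a le_rfl
    rw [positionsBelow_self, List.drop_of_length_le (by simp)] at h
    rw [← h, Finset.sum_filter]
    refine Finset.sum_congr rfl fun p _ => ?_
    simp only [inversionTerm, IsInversionTerm, pendingTerm_nil_eq, wick_nil, mul_one, ite_self,
      Finset.card_univ, Fintype.card_fin, contraction_eq_contractionOn]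
  · have h := separatedSum_composition (E : M → D) hbim.map_right a c le_rfl
    rw [Composition.sizeUpTo_length, List.take_of_length_le (by simp), separatedSum,
      positionsBelow_self] at h
    rw [← h, Finset.sum_filter]
    refine Finset.sum_congr rfl fun p _ => ?_
    classical
    exact if_congr (and_congr (inf_blockPartition_eq_bot_iff c p.1) Iff.rfl).symm rfl rfl
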